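/- \textbf{Setting.} All Banach spaces are complex. For $n\in\mathbb N$ and $1\le q\le\infty$ let $\ell^n_q$ be $\mathbb C^n$ with the norm $\|z\|_q=(\sum_i|z_i|^q)^{1/q}$ ($\max_i|z_i|$ if $q=\infty$), with open unit ball $B_{\ell^n_q}$, and let $q'$ be the conjugate exponent, $1/q+1/q'=1$. For a bounded holomorphic $f:B_{\ell^n_q}\to X$ put $x_\alpha(f)=\partial^\alpha f(0)/\alpha!$ for $\alpha\in\mathbb N_0^n$, and $\|f\|=\sup_{z\in B_{\ell^n_q}}\|f(z)\|_X$. For $1\le p<\infty$ and $\lambda\ge1$ the $\lambda_p$-arithmetic Bohr radius is $$A_p(B_{\ell^n_q},X,\lambda)=\sup\Big\{\tfrac1n\sum_{i=1}^n\rho_i \;:\; \rho\in\mathbb R^n_{\ge0},\ \sum_{\alpha\in\mathbb N_0^n}\|x_\alpha(f)\|^p\rho^{p\alpha}\le\lambda\|f\|^p\ \text{for all bounded holomorphic } f:B_{\ell^n_q}\to X\Big\}.$$ Let $\pi_1(\mathrm{Id}_X)$ be the best constant $c$ such that $\sum_{j=1}^k\|x_j\|\le c\,\sup_{x^*\in B_{X^*}}\sum_{j=1}^k|x^*(x_j)|$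 for every finite family $x_1,\dots,x_k\in X$. \textbf{Theorem.} Let $X\neq\{0\}$ be a finite-dimensional complex Banach space and put $$C=e^{-1}\inf_{m\ge1}\big(\pi_1(\mathrm{Id}_X)\big)^{-1/m},$$ a constant that depends only on $\pi_1(\mathrm{Id}_X)$. Then $C>0$, and for all $1\le p<\infty$, $\lambda\ge1$, $1\le q\le\infty$ and all integers $n>1$, with $r=pq'/(pq'-1)$ (read as $r=1$ if $q'=\infty$ and $r=\infty$ if $pq'=1$; $1/\infty=0$), $$A_p(B_{\ell^n_q},X,\lambda)\ \ge\ C\Big(\frac{\lambda-1}{2\lambda-1}\Big)^{1/p} n^{-1/q}\Big(\frac{\log n}{n}\Big)^{1-1/r}\quad\text{if } q\le r,$$ $$A_p(B_{\ell^n_q},X,\lambda)\ \ge\ C\Big(\frac{\lambda-1}{2\lambda-1}\Big)^{1/p} n^{-1/r}\Big(\frac{\log n}{n}\Big)^{1-1/r}\quad\text{if } r<q.$$ -/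

import Mathlib

open scoped ENNReal NNReal Nat

noncomputable section

/-- The complex Minkowski space `ℓ^n_q` : `ℂ^n` with the `q`-norm (the maximum norm if `q = ∞`). -/
abbrev EllNQ (n : ℕ) (q : ℝ≥0∞) : Type := PiLp q (fun _ : Fin n => ℂ)

/-- The inequality saying that `c` is an admissible constant in the definition of an
`(r, s)`-summing operator. The supremum is over the open unit ball of the topological dual. -/
def IsSummingConstant {X Y : Type*} [NormedAddCommGroup X] [NormedSpace ℂ X]
    [NormedAddCommGroup Y] [NormedSpace ℂ Y] (r s : ℝ) (T : X →L[ℂ] Y) (c : ℝ) : Prop :=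
  ∀ (k : ℕ) (x : Fin k → X),
    (∑ j, ‖T (x j)‖ ^ r) ^ (1 / r) ≤
      c * ⨆ g : Metric.ball (0 : X →L[ℂ] ℂ) 1,
        (∑ j, ‖(g : X →L[ℂ] ℂ) (x j)‖ ^ s) ^ (1 / s)

/-- The `(r, s)`-summing norm `π_{r,s}(T)` of an `(r, s)`-summing operator: the best constant. -/
def summingNorm {X Y : Type*} [NormedAddCommGroup X] [NormedSpace ℂ X]
    [NormedAddCommGroup Y] [NormedSpace ℂ Y] (r s : ℝ) (T : X →L[ℂ] Y) : ℝ :=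
  sInf {c : ℝ | 0 < c ∧ IsSummingConstant r s T c}

/-- The nondecreasing index `j_α = (1, …, 1, 2, …, 2, …, n, …, n)` of a multi-index `α`, in which
`i` occurs `α i` times; its length is `|α|`. -/
def indexList {n : ℕ} (α : Fin n → ℕ) : List (Fin n) :=
  (List.finRange n).flatMap fun i => List.replicate (α i) i

/-- The mixed partial derivative `∂^α f (0)`, i.e. the derivative of order `|α|` of `f` at `0`
in the directions `e_j`, for `j` running through the index `j_α`. -/
def mixedPartialAtZero {n : ℕ} {q : ℝ≥0∞} [Fact (1 ≤ q)]
    {X : Type*} [NormedAddCommGroup X] [NormedSpace ℂ X]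
    (f : EllNQ n q → X) (α : Fin n → ℕ) : X :=
  iteratedFDeriv ℂ (indexList α).length f 0
    fun k => WithLp.toLp q (Pi.single ((indexList α).get k) (1 : ℂ))

/-- The monomial coefficient `x_α(f) = ∂^α f (0) / α!`. -/
def monomialCoeff {n : ℕ} {q : ℝ≥0∞} [Fact (1 ≤ q)]
    {X : Type*} [NormedAddCommGroup X] [NormedSpace ℂ X]
    (f : EllNQ n q → X) (α : Fin n → ℕ) : X :=
  ((∏ i, (α i)! : ℕ) : ℂ)⁻¹ • mixedPartialAtZero f α

/-- The supremum of `‖f z‖` over the open unit ball of `ℓ^n_q`, in `[0, ∞]`. -/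
def ballSupNorm {n : ℕ} {q : ℝ≥0∞} [Fact (1 ≤ q)]
    {X : Type*} [NormedAddCommGroup X] (f : EllNQ n q → X) : ℝ≥0∞ :=
  ⨆ z ∈ Metric.ball (0 : EllNQ n q) 1, ‖f z‖ₑ

/-- `H_∞(B_{ℓ^n_q}, X)`: the functions that are holomorphic and bounded on the open unit ball of
`ℓ^n_q`. (Functions are total in Lean; values off the ball are irrelevant.) -/
def HInfty (n : ℕ) (q : ℝ≥0∞) [Fact (1 ≤ q)]
    (X : Type*) [NormedAddCommGroup X] [NormedSpace ℂ X] : Set (EllNQ n q → X) :=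
  {f | DifferentiableOn ℂ f (Metric.ball 0 1) ∧ ∃ M : ℝ, ∀ z ∈ Metric.ball 0 1, ‖f z‖ ≤ M}

/-- The `λ_p`-arithmetic Bohr radius with respect to a class `F` of functions on the open unit
ball of `ℓ^n_q` : the supremum, in `[0, ∞]`, of the means `(ρ_1 + … + ρ_n) / n` over all
`ρ ∈ ℝ^n_{≥ 0}` such that `∑_α ‖x_α(f)‖^p ρ^{pα} ≤ λ ‖f‖^p` for all `f ∈ F`. -/
def arithmeticBohrRadiusOf {n : ℕ} {q : ℝ≥0∞} [Fact (1 ≤ q)]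
    {X : Type*} [NormedAddCommGroup X] [NormedSpace ℂ X]
    (p : ℝ) (F : Set (EllNQ n q → X)) (lam : ℝ) : ℝ≥0∞ :=
  ⨆ (ρ : Fin n → ℝ≥0)
    (_ : ∀ f ∈ F, ∑' α : Fin n → ℕ,
        ‖monomialCoeff f α‖ₑ ^ p * ∏ i, (ρ i : ℝ≥0∞) ^ (p * (α i : ℝ))
          ≤ ENNReal.ofReal lam * ballSupNorm f ^ p),
    (∑ i, (ρ i : ℝ≥0∞)) / (n : ℝ≥0∞)

/-- `A_p(B_{ℓ^n_q}, X, λ)`, the `λ_p`-arithmetic Bohr radius with respect to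
`H_∞(B_{ℓ^n_q}, X)`. -/
def arithmeticBohrRadius (p : ℝ) (n : ℕ) (q : ℝ≥0∞) [Fact (1 ≤ q)]
    (X : Type*) [NormedAddCommGroup X] [NormedSpace ℂ X] (lam : ℝ) : ℝ≥0∞ :=
  arithmeticBohrRadiusOf p (HInfty n q X) lam

/-- The exponent `r = p q' / (p q' - 1)`, i.e. the conjugate exponent of `p q'`, where `q'` is the
conjugate exponent of `q`. As usual, `r = 1` if `q' = ∞` and `r = ∞` if `p q' = 1`
(`ENNReal.conjExponent t` is `1 + 1 / (t - 1)`, computed in `[0, ∞]`). -/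
def bohrExponent (p : ℝ) (q : ℝ≥0∞) : ℝ≥0∞ :=
  ENNReal.conjExponent (ENNReal.ofReal p * ENNReal.conjExponent q)

end

/-! ### Holomorphic maps in finitely many variables: smoothness and Cauchy estimates -/

section Smooth

variable {E F : Type*} [NormedAddCommGroup E] [NormedSpace ℂ E]
  [NormedAddCommGroup F] [NormedSpace ℂ F]

/-! The witness is a constant vector `ρ`. Since `1 - 1/r = (1 - 1/q)/p`, the first bound asks for `ρ
= C t^{1/p} n^{-1/q} (log n / n)^{(1-1/q)/p}` with `t = (λ-1)/(2λ-1)`. The second follows from it,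
because `r < q` gives `n^{-1/r} ≤ n^{-1/q}`.

Let `‖f‖ ≤ M`. By Cauchy's estimate the degree `m` part of `f` is bounded by `M ‖z‖^m`. The heart is
the scalar estimate `sum_norm_coeff_le`: if `P = ∑ c_α z^α` has degree `k+1` and `|P(z)| ≤ M
‖z‖^{k+1}`, then `∑ |c_α| ≤ M 2^k (e n / (log n)^{1-1/q})^{k+1}`. To see it, differentiate `P` in a
direction `u` whose phases align the terms `c_{β+e_i} u_i`, and apply Cauchy's coefficient estimate
at `z^β` on the torus of radii `(β_i/k)^{1/q}`. Summing over `β` leaves powers `1/q` of multinomial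
coefficients. Hölder bounds these by their sum `n^k` and their number `(n+k-1).choose k`, and the
latter is what produces the logarithm.

Applied to `g ∘ f` for functionals `g` of norm at most one, this becomes a bound on `∑ ‖x_α‖` at the
cost of one factor `π_1(Id_X)`. The power `p` comes from `‖x_α‖^p = ‖x_α‖ ‖x_α‖^{p-1}` and `‖x_α‖ ≤
M n^{m/q}`. The constant satisfies `(C e)^m π_1(Id_X) ≤ 1` for every `m ≥ 1`, so degree `k+1`
contributes at most `M^p t^{k+1} 2^k`. These sum to `(λ-1) M^p`, and the constant term adds at most
`M^p`. -/

theorem exists_ball_lipschitzOnWith_of_differentiableOn {f : E → F} {U : Set E} (hU : IsOpen U)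
    (hf : DifferentiableOn ℂ f U) {z : E} (hz : z ∈ U) :
    ∃ r > 0, Metric.ball z r ⊆ U ∧ ∃ K : ℝ≥0, LipschitzOnWith K f (Metric.ball z r) := by
  have hc : ContinuousAt f z := (hf.differentiableAt (hU.mem_nhds hz)).continuousAt
  obtain ⟨δ, hδ, hδf⟩ := Metric.continuousAt_iff.1 hc 1 one_pos
  obtain ⟨ε, hε, hεU⟩ := Metric.isOpen_iff.1 hU z hz
  set r := min δ ε / 2 with hr
  have hr0 : 0 < r := by positivity
  have h1 : r + r ≤ δ := by rw [hr, add_halves]; exact min_le_left _ _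
  have h2 : r + r ≤ ε := by rw [hr, add_halves]; exact min_le_right _ _
  have hsub : Metric.ball z r ⊆ U :=
    (Metric.ball_subset_ball (by linarith)).trans hεU
  refine ⟨r, hr0, hsub, Real.toNNReal (2 / r), ?_⟩
  refine Convex.lipschitzOnWith_of_nnnorm_fderiv_le (𝕜 := ℂ)
    (fun x hx => hf.differentiableAt (hU.mem_nhds (hsub hx))) ?_ (convex_ball z r)
  intro x hx
  rw [← NNReal.coe_le_coe, Real.coe_toNNReal _ (by positivity), coe_nnnorm]
  have hb : Metric.ball x r ⊆ Metric.ball z (r + r) := by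
    intro y hy
    rw [Metric.mem_ball] at *
    linarith [dist_triangle y x z]
  refine Complex.norm_fderiv_le_div_of_mapsTo_ball
    (hf.mono (hb.trans ((Metric.ball_subset_ball h2).trans hεU))) ?_ hr0
  intro y hy
  have h3 := hδf (Metric.ball_subset_ball h1 (hb hy))
  have h4 := hδf (lt_of_lt_of_le (Metric.mem_ball.1 hx) (by linarith))
  rw [Metric.mem_closedBall]
  linarith [dist_triangle (f y) (f z) (f x), dist_comm (f z) (f x)]

variable [FiniteDimensional ℂ E] [FiniteDimensional ℂ F]

/-- Cauchy's formula on the complex line through `z` in direction `v` writes the directional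
derivative as a circle integral of values of `f`. The local Lipschitz bound allows differentiation
in `z` under the integral. Iterating this gives smoothness. -/
theorem differentiableOn_fderiv_apply {f : E → F} {U : Set E} (hU : IsOpen U)
    (hf : DifferentiableOn ℂ f U) (v : E) :
    DifferentiableOn ℂ (fun z => fderiv ℂ f z v) U := by
  intro z₀ hz₀
  refine DifferentiableAt.differentiableWithinAt ?_
  obtain ⟨r, hr, hrU, K, hK⟩ := exists_ball_lipschitzOnWith_of_differentiableOn hU hf hz₀
  -- Small enough that the circle of radius `ε` about any `z` within `r / 2` of `z₀` stays in the
  -- ball of radius `r`.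
  set ε : ℝ := r / 2 / (‖v‖ + 1) with hε
  have hv : 0 < ‖v‖ + 1 := by positivity
  have hε0 : 0 < ε := by positivity
  have hball : ∀ z ∈ Metric.ball z₀ (r / 2), ∀ w : ℂ, ‖w‖ ≤ ε → z + w • v ∈ Metric.ball z₀ r := by
    intro z hz w hw
    rw [Metric.mem_ball, dist_eq_norm] at *
    have h1 : ‖w • v‖ ≤ r / 2 := by
      rw [norm_smul]
      calc ‖w‖ * ‖v‖ ≤ ε * (‖v‖ + 1) := by gcongr; linarith
        _ = r / 2 := by rw [hε]; field_simp
    calc ‖z + w • v - z₀‖ = ‖(z - z₀) + w • v‖ := by congr 1; abel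
      _ ≤ ‖z - z₀‖ + ‖w • v‖ := norm_add_le _ _
      _ < r := by linarith
  have hdf : ∀ y ∈ Metric.ball z₀ r, DifferentiableAt ℂ f y :=
    fun y hy => hf.differentiableAt (hU.mem_nhds (hrU hy))
  have hcirc : ∀ θ : ℝ, ‖circleMap 0 ε θ‖ ≤ ε := by
    intro θ; simp [abs_of_pos hε0]
  set G : E → ℝ → F := fun z θ =>
    (deriv (circleMap 0 ε) θ * ((circleMap 0 ε θ - 0) ^ 2)⁻¹) • f (z + circleMap 0 ε θ • v) with hG
  have hrep : ∀ z ∈ Metric.ball z₀ (r / 2),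
      fderiv ℂ f z v = (2 * Real.pi * Complex.I : ℂ)⁻¹ • ∫ θ in (0 : ℝ)..2 * Real.pi, G z θ := by
    intro z hz
    have hz' : z ∈ Metric.ball z₀ r := Metric.ball_subset_ball (by linarith) hz
    have hd : deriv (fun w : ℂ => f (z + w • v)) 0 = fderiv ℂ f z v := by
      have h1 : HasDerivAt (fun w : ℂ => z + w • v) v 0 := by
        simpa using ((hasDerivAt_id (0 : ℂ)).smul_const v).const_add z
      have h2 : HasFDerivAt f (fderiv ℂ f z) (z + (0 : ℂ) • v) := by
        simpa using (hdf z hz').hasFDerivAt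
      exact (h2.comp_hasDerivAt (0 : ℂ) h1).deriv
    have hopen : IsOpen ((fun w : ℂ => z + w • v) ⁻¹' Metric.ball z₀ r) :=
      Metric.isOpen_ball.preimage (by fun_prop)
    have := Complex.cderiv_eq_deriv (f := fun w : ℂ => f (z + w • v)) (z := 0) hopen
      (fun w hw => ((hdf _ hw).comp w (by fun_prop)).differentiableWithinAt) hε0
      (fun w hw => hball z hz w (by simpa using hw))
    rw [← hd, ← this, Complex.cderiv, circleIntegral]
    simp only [hG, smul_smul]
  have hGc : ∀ z ∈ Metric.ball z₀ (r / 2), Continuous (G z) := by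
    intro z hz
    have h1 : Continuous fun θ => f (z + circleMap 0 ε θ • v) := by
      rw [continuous_iff_continuousAt]
      intro θ
      refine ContinuousAt.comp (f := fun θ => z + circleMap 0 ε θ • v) (g := f)
        (hdf _ (hball z hz _ (hcirc θ))).continuousAt ?_
      fun_prop
    have h2 : Continuous fun θ => deriv (circleMap 0 ε) θ * ((circleMap 0 ε θ - 0) ^ 2)⁻¹ := by
      simp only [deriv_circleMap]
      refine Continuous.mul (by fun_prop) (Continuous.inv₀ (by fun_prop) ?_)
      intro θ
      simp [hε0.ne']
    exact h2.smul h1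
  have hker : ∀ θ : ℝ, ‖deriv (circleMap 0 ε) θ * ((circleMap 0 ε θ - 0) ^ 2)⁻¹‖ = 1 / ε := by
    intro θ
    simp [abs_of_pos hε0]
    field_simp
  let : MeasurableSpace E := borel E
  have : BorelSpace E := ⟨rfl⟩
  let : MeasurableSpace (E →L[ℂ] F) := borel _
  have : BorelSpace (E →L[ℂ] F) := ⟨rfl⟩
  have : FiniteDimensional ℝ E := FiniteDimensional.complexToReal E
  have : FiniteDimensional ℝ (E →L[ℂ] F) := FiniteDimensional.complexToReal _
  have : CompleteSpace F := FiniteDimensional.complete ℂ F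
  have : ProperSpace (E →L[ℂ] F) := FiniteDimensional.proper ℂ _
  have key := hasFDerivAt_integral_of_dominated_loc_of_lip (𝕜 := ℂ)
    (μ := MeasureTheory.volume.restrict (Set.Ioc 0 (2 * Real.pi)))
    (F := G) (x₀ := z₀) (bound := fun _ => 1 / ε * K) (s := Metric.ball z₀ (r / 2))
    (F' := fun θ => (deriv (circleMap 0 ε) θ * ((circleMap 0 ε θ - 0) ^ 2)⁻¹) •
      fderiv ℂ f (z₀ + circleMap 0 ε θ • v))
    (Metric.ball_mem_nhds _ (by positivity))
    (by
      filter_upwards [Metric.ball_mem_nhds z₀ (half_pos hr)] with z hz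
      exact (hGc z hz).aestronglyMeasurable)
    ((hGc z₀ (Metric.mem_ball_self (half_pos hr))).integrableOn_Ioc)
    (by
      -- Continuity of the derivative is not yet known; measurability of `fderiv` suffices.
      refine Measurable.aestronglyMeasurable ?_
      have hm : Measurable fun θ : ℝ => fderiv ℂ f (z₀ + circleMap 0 ε θ • v) :=
        (measurable_fderiv ℂ f).comp (by
          refine Continuous.measurable ?_
          fun_prop)
      have hk : Measurable fun θ : ℝ =>
          deriv (circleMap 0 ε) θ * ((circleMap 0 ε θ - 0) ^ 2)⁻¹ := by
        simp only [deriv_circleMap]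
        exact Measurable.mul (by fun_prop) (Measurable.inv (by fun_prop))
      exact hk.smul hm)
    (by
      refine Filter.Eventually.of_forall fun θ => ?_
      refine LipschitzOnWith.of_dist_le_mul fun x hx y hy => ?_
      have h1 := hK.dist_le_mul _ (hball x hx _ (hcirc θ)) _ (hball y hy _ (hcirc θ))
      rw [dist_add_right] at h1
      simp only [hG]
      rw [dist_eq_norm, ← smul_sub, norm_smul, hker, ← dist_eq_norm, Real.coe_nnabs,
        abs_of_nonneg (by positivity), mul_assoc]
      gcongr)
    (MeasureTheory.integrable_const _)
    (by
      refine Filter.Eventually.of_forall fun θ => ?_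
      have h1 : HasFDerivAt (fun x => f (x + circleMap 0 ε θ • v))
          (fderiv ℂ f (z₀ + circleMap 0 ε θ • v)) z₀ := by
        have h2 := (hdf _ (hball z₀ (Metric.mem_ball_self (half_pos hr)) _ (hcirc θ))).hasFDerivAt
        exact (hasFDerivAt_comp_add_right (circleMap 0 ε θ • v)).2 h2
      exact h1.const_smul _)
  have h3 : DifferentiableAt ℂ (fun z => (2 * Real.pi * Complex.I : ℂ)⁻¹ •
      ∫ θ in (0 : ℝ)..2 * Real.pi, G z θ) z₀ := by
    simp only [intervalIntegral.integral_of_le Real.two_pi_pos.le]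
    exact key.2.differentiableAt.const_smul _
  refine h3.congr_of_eventuallyEq ?_
  filter_upwards [Metric.ball_mem_nhds z₀ (half_pos hr)] with z hz
  exact hrep z hz

theorem contDiffOn_of_differentiableOn_of_finiteDimensional {f : E → F} {U : Set E} (hU : IsOpen U)
    (hf : DifferentiableOn ℂ f U) (m : ℕ) : ContDiffOn ℂ m f U := by
  induction m generalizing f with
  | zero => simpa using hf.continuousOn
  | succ m ih =>
    push_cast
    rw [contDiffOn_succ_iff_fderiv_of_isOpen hU]
    refine ⟨hf, by simp, ?_⟩
    rw [contDiffOn_clm_apply]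
    exact fun v => ih (differentiableOn_fderiv_apply hU hf v)

/-- Iterated directional derivatives along the directions in a list. -/
noncomputable def dirDeriv (l : List E) (f : E → F) : E → F :=
  l.foldr (fun v g z => fderiv ℂ g z v) f

theorem differentiableOn_dirDeriv {f : E → F} {U : Set E} (hU : IsOpen U)
    (hf : DifferentiableOn ℂ f U) (l : List E) : DifferentiableOn ℂ (dirDeriv l f) U := by
  induction l with
  | nil => exact hf
  | cons v l ih => exact differentiableOn_fderiv_apply hU ih v

/-- Adjacent transpositions generate all permutations, and for them this is the symmetry of the
second derivative. -/
theorem dirDeriv_perm {f : E → F} {U : Set E} (hU : IsOpen U) (hf : DifferentiableOn ℂ f U)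
    {l₁ l₂ : List E} (h : l₁.Perm l₂) : Set.EqOn (dirDeriv l₁ f) (dirDeriv l₂ f) U := by
  induction h with
  | nil => exact fun _ _ => rfl
  | cons v _ ih =>
    intro z hz
    exact DFunLike.congr_fun (ih.eventuallyEq_of_mem (hU.mem_nhds hz)).fderiv_eq v
  | swap u v l =>
    intro z hz
    set g := dirDeriv l f with hg
    have hgd : DifferentiableOn ℂ g U := differentiableOn_dirDeriv hU hf l
    have hc : ContDiffAt ℂ (2 : ℕ) g z :=
      (contDiffOn_of_differentiableOn_of_finiteDimensional hU hgd 2).contDiffAt (hU.mem_nhds hz)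
    have hdd : DifferentiableAt ℂ (fderiv ℂ g) z :=
      (hc.fderiv_right (m := 1) (by norm_num)).differentiableAt (by norm_num)
    have h2 : ∀ a b : E, fderiv ℂ (fun y => fderiv ℂ g y a) z b = fderiv ℂ (fderiv ℂ g) z b a := by
      intro a b
      rw [fderiv_clm_apply hdd (by fun_prop)]
      simp
    change fderiv ℂ (fun y => fderiv ℂ g y u) z v = fderiv ℂ (fun y => fderiv ℂ g y v) z u
    rw [h2, h2]
    exact (hc.isSymmSndFDerivAt (by simp)) v u
  | trans _ _ ih₁ ih₂ => exact ih₁.trans ih₂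

theorem iteratedFDeriv_eq_dirDeriv {f : E → F} {U : Set E} (hU : IsOpen U)
    (hf : DifferentiableOn ℂ f U) (m : ℕ) (v : Fin m → E) :
    Set.EqOn (fun z => iteratedFDeriv ℂ m f z v) (dirDeriv (List.ofFn v) f) U := by
  induction m with
  | zero => intro z _; simp [dirDeriv]
  | succ m ih =>
    intro z hz
    have hd : DifferentiableAt ℂ (iteratedFDeriv ℂ m f) z :=
      ((contDiffOn_of_differentiableOn_of_finiteDimensional hU hf (m + 1)).contDiffAt
        (hU.mem_nhds hz)).differentiableAt_iteratedFDeriv (by exact_mod_cast Nat.lt_succ_self m)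
    simp only [iteratedFDeriv_succ_apply_left, List.ofFn_succ]
    change _ = fderiv ℂ (dirDeriv (List.ofFn fun i : Fin m => v i.succ) f) z (v 0)
    rw [← ((ih fun i => v i.succ).eventuallyEq_of_mem (hU.mem_nhds hz)).fderiv_eq]
    have : HasFDerivAt (fun y => iteratedFDeriv ℂ m f y fun i => v i.succ)
        ((ContinuousMultilinearMap.apply ℂ (fun _ : Fin m => E) F fun i => v i.succ).comp
          (fderiv ℂ (iteratedFDeriv ℂ m f) z)) z :=
      ((ContinuousMultilinearMap.apply ℂ (fun _ : Fin m => E) F fun i => v i.succ).hasFDerivAt).comp z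
        hd.hasFDerivAt
    rw [this.fderiv]
    rfl

theorem iteratedFDeriv_get_eq_of_perm {f : E → F} {U : Set E} (hU : IsOpen U)
    (hf : DifferentiableOn ℂ f U) {ι : Type*} (e : ι → E) {m : ℕ} (i : Fin m → ι) {l : List ι}
    (h : (List.ofFn i).Perm l) {z : E} (hz : z ∈ U) :
    iteratedFDeriv ℂ m f z (fun k => e (i k)) =
      iteratedFDeriv ℂ l.length f z fun k => e (l.get k) := by
  have h1 := iteratedFDeriv_eq_dirDeriv hU hf m (fun k => e (i k)) hz
  have h2 := iteratedFDeriv_eq_dirDeriv hU hf l.length (fun k => e (l.get k)) hz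
  simp only at h1 h2
  rw [h1, h2]
  refine dirDeriv_perm hU hf ?_ hz
  have := h.map e
  rw [List.map_ofFn] at this
  have hl : (List.ofFn fun k => e (l.get k)) = l.map e := List.ext_get (by simp) (by simp)
  rw [hl]
  exact this

theorem iteratedDeriv_comp_smul {f : E → F} {U : Set E} (hU : IsOpen U)
    (hf : DifferentiableOn ℂ f U) (h0 : (0 : E) ∈ U) (m : ℕ) (z : E) :
    iteratedDeriv m (fun w : ℂ => f (w • z)) 0 = iteratedFDeriv ℂ m f 0 fun _ => z := by
  set g : ℂ →L[ℂ] E := ContinuousLinearMap.toSpanSingleton ℂ z with hg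
  have hV : IsOpen (g ⁻¹' U) := hU.preimage g.continuous
  have hm0 : g 0 ∈ U := by simpa using h0
  have := g.iteratedFDerivWithin_comp_right (contDiffOn_of_differentiableOn_of_finiteDimensional hU hf m)
    hU.uniqueDiffOn hV.uniqueDiffOn hm0 (i := m) le_rfl
  rw [iteratedFDerivWithin_of_isOpen m hV hm0, iteratedFDerivWithin_of_isOpen m hU hm0] at this
  rw [iteratedDeriv_eq_iteratedFDeriv]
  have h2 := DFunLike.congr_fun this fun _ => (1 : ℂ)
  simpa [hg, Function.comp_def] using h2

theorem norm_iteratedFDeriv_diag_le {f : E → F} {M : ℝ} (hf : DifferentiableOn ℂ f (Metric.ball 0 1))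
    (hM : ∀ z ∈ Metric.ball (0 : E) 1, ‖f z‖ ≤ M) (m : ℕ) (z : E) :
    ‖iteratedFDeriv ℂ m f 0 fun _ => z‖ ≤ m ! * M * ‖z‖ ^ m := by
  have : CompleteSpace F := FiniteDimensional.complete ℂ F
  have key : ∀ y : E, ‖y‖ < 1 → ‖iteratedFDeriv ℂ m f 0 fun _ => y‖ ≤ m ! * M := by
    intro y hy
    rw [← iteratedDeriv_comp_smul Metric.isOpen_ball hf (Metric.mem_ball_self one_pos) m y]
    have hb : ∀ w ∈ Metric.closedBall (0 : ℂ) 1, w • y ∈ Metric.ball (0 : E) 1 := by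
      intro w hw
      rw [mem_closedBall_zero_iff] at hw
      rw [mem_ball_zero_iff, norm_smul]
      nlinarith [norm_nonneg y, norm_nonneg w]
    have := Complex.norm_iteratedDeriv_le_of_forall_mem_sphere_norm_le (f := fun w : ℂ => f (w • y))
      (c := 0) (C := M) m one_pos
      (DifferentiableOn.diffContOnCl (by
        rw [closure_ball _ one_ne_zero]
        exact hf.comp (by fun_prop) hb))
      (fun w hw => hM _ (hb w (Metric.sphere_subset_closedBall hw)))
    simpa using this
  -- Rescaling `z` by `a > ‖z‖` puts it in the open ball; letting `a` decrease to `‖z‖` also covers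
  -- `z = 0`.
  have hlim : Filter.Tendsto (fun a : ℝ => m ! * M * a ^ m) (nhdsWithin ‖z‖ (Set.Ioi ‖z‖))
      (nhds (m ! * M * ‖z‖ ^ m)) := by
    refine Filter.Tendsto.mono_left ?_ nhdsWithin_le_nhds
    exact Continuous.tendsto (by fun_prop) _
  refine ge_of_tendsto hlim ?_
  filter_upwards [self_mem_nhdsWithin] with a ha
  have ha0 : 0 < a := (norm_nonneg z).trans_lt ha
  have h1 := key ((a : ℂ)⁻¹ • z) (by
    rw [norm_smul, norm_inv, Complex.norm_real, Real.norm_of_nonneg ha0.le, inv_mul_lt_iff₀ ha0]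
    simpa using ha)
  have h2 := (iteratedFDeriv ℂ m f 0).map_smul_univ (fun _ => (a : ℂ)⁻¹) (fun _ => z)
  rw [h2, norm_smul] at h1
  simp only [Finset.prod_const, Finset.card_univ, Fintype.card_fin, norm_pow, norm_inv,
    Complex.norm_real, Real.norm_of_nonneg ha0.le] at h1
  rw [inv_pow, inv_mul_le_iff₀ (by positivity)] at h1
  linarith

end Smooth

/-! ### Monomial expansion of the homogeneous parts -/

section Expansion

/-- Both sides are images of the `m`-th power of one linear form in the monoid algebra of `ℕ^n`,
expanded over index tuples and by the multinomial theorem, under the linear map sending the monomial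
`α` to `G α`. -/
theorem sum_fin_prod_smul_eq_sum_piAntidiag {X : Type*} [AddCommGroup X] [Module ℂ X] {n : ℕ}
    (m : ℕ) (z : Fin n → ℂ) (G : (Fin n → ℕ) → X) :
    ∑ i : Fin m → Fin n, (∏ k, z (i k)) • G (∑ k, Pi.single (i k) 1) =
      ∑ α ∈ Finset.piAntidiag Finset.univ m,
        ((Nat.multinomial Finset.univ α : ℂ) * ∏ j, z j ^ α j) • G α := by
  set f : Fin n → AddMonoidAlgebra ℂ (Fin n → ℕ) :=
    fun i => AddMonoidAlgebra.single (Pi.single i 1) (z i) with hf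
  have h1 : (∑ i, f i) ^ m =
      ∑ i : Fin m → Fin n, AddMonoidAlgebra.single (∑ k, Pi.single (i k) 1) (∏ k, z (i k)) := by
    rw [Fintype.sum_pow]
    refine Finset.sum_congr rfl fun i _ => ?_
    simp only [hf]
    induction (Finset.univ : Finset (Fin m)) using Finset.cons_induction with
    | empty => simp [AddMonoidAlgebra.one_def]
    | cons a s ha ih => simp
  have h2 : (∑ i, f i) ^ m = ∑ α ∈ Finset.piAntidiag Finset.univ m,
      AddMonoidAlgebra.single α ((Nat.multinomial Finset.univ α : ℂ) * ∏ j, z j ^ α j) := by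
    rw [Finset.sum_pow_eq_sum_piAntidiag]
    refine Finset.sum_congr rfl fun α _ => ?_
    have h3 : ∀ s : Finset (Fin n), ∏ j ∈ s, f j ^ α j =
        AddMonoidAlgebra.single (∑ j ∈ s, Pi.single j (α j)) (∏ j ∈ s, z j ^ α j) := by
      intro s
      induction s using Finset.cons_induction with
      | empty => simp [AddMonoidAlgebra.one_def]
      | cons a s ha ih =>
        have h4 : α a • (Pi.single a 1 : Fin n → ℕ) = Pi.single a (α a) := by
          rw [← Pi.single_smul, smul_eq_mul, mul_one]
        rw [Finset.prod_cons, Finset.prod_cons, Finset.sum_cons, ih, hf,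
          AddMonoidAlgebra.single_pow, AddMonoidAlgebra.single_mul_single, h4]
    rw [h3, Finset.univ_sum_single, ← nsmul_eq_mul, ← nsmul_eq_mul, AddMonoidAlgebra.smul_single]
  set Φ : AddMonoidAlgebra ℂ (Fin n → ℕ) →+ X :=
    (Finsupp.linearCombination ℂ G).toAddMonoidHom.comp
      AddMonoidAlgebra.coeffAddEquiv.toAddMonoidHom with hΦ
  have hs : ∀ α r, Φ (AddMonoidAlgebra.single α r) = r • G α := by
    intro α r
    simp [hΦ]
  have h5 := congrArg Φ (h1.symm.trans h2)
  simpa only [map_sum, hs] using h5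

theorem count_indexList {n : ℕ} (α : Fin n → ℕ) (a : Fin n) : (indexList α).count a = α a := by
  rw [indexList, List.count_flatMap]
  simp only [Function.comp_def, List.count_replicate, beq_iff_eq]
  rw [← List.ofFn_eq_map, List.sum_ofFn]
  simp

theorem ofFn_perm_indexList {n m : ℕ} (i : Fin m → Fin n) :
    (List.ofFn i).Perm (indexList (∑ k, Pi.single (i k) 1)) := by
  rw [List.perm_iff_count]
  intro a
  rw [count_indexList]
  induction m with
  | zero => simp
  | succ m ih =>
    rw [List.ofFn_succ, List.count_cons, ih, Fin.sum_univ_succ]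
    simp [Pi.single_apply, add_comm, @eq_comm _ a]

variable {X : Type*} [NormedAddCommGroup X] [NormedSpace ℂ X] [FiniteDimensional ℂ X]
  {n : ℕ} {q : ℝ≥0∞} [Fact (1 ≤ q)]

theorem sum_monomialCoeff_eq_iteratedFDeriv {f : EllNQ n q → X}
    (hf : DifferentiableOn ℂ f (Metric.ball 0 1)) (m : ℕ) (z : EllNQ n q) :
    ∑ α ∈ Finset.piAntidiag Finset.univ m, (∏ j, z j ^ α j) • monomialCoeff f α =
      (m ! : ℂ)⁻¹ • iteratedFDeriv ℂ m f 0 fun _ => z := by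
  have hz : z = ∑ j, z j • (WithLp.toLp q (Pi.single j (1 : ℂ)) : EllNQ n q) := by
    ext i
    simp [Finset.sum_apply, Pi.single_apply]
  have h1 : (iteratedFDeriv ℂ m f 0 fun _ => z) =
      ∑ i : Fin m → Fin n, (∏ k, z (i k)) • mixedPartialAtZero f (∑ k, Pi.single (i k) 1) := by
    conv_lhs => rw [hz]
    rw [ContinuousMultilinearMap.map_sum]
    refine Finset.sum_congr rfl fun i _ => ?_
    rw [ContinuousMultilinearMap.map_smul_univ]
    congr 1
    exact iteratedFDeriv_get_eq_of_perm Metric.isOpen_ball hf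
      (fun j => (WithLp.toLp q (Pi.single j (1 : ℂ)) : EllNQ n q)) i (ofFn_perm_indexList i)
      (Metric.mem_ball_self one_pos)
  rw [h1, sum_fin_prod_smul_eq_sum_piAntidiag m z, Finset.smul_sum]
  refine Finset.sum_congr rfl fun α hα => ?_
  rw [monomialCoeff, smul_smul, smul_smul]
  congr 1
  have h2 := Nat.multinomial_spec Finset.univ α
  rw [(Finset.mem_piAntidiag.1 hα).1] at h2
  rw [← h2]
  have h3 : ((∏ i, (α i)! : ℕ) : ℂ) ≠ 0 :=
    Nat.cast_ne_zero.2 (Finset.prod_ne_zero_iff.2 fun i _ => (α i).factorial_ne_zero)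
  have h4 : (Nat.multinomial Finset.univ α : ℂ) ≠ 0 :=
    Nat.cast_ne_zero.2 (Nat.multinomial_pos _ _).ne'
  rw [Nat.cast_mul]
  field_simp

theorem norm_sum_monomialCoeff_le {f : EllNQ n q → X} {M : ℝ}
    (hf : DifferentiableOn ℂ f (Metric.ball 0 1))
    (hM : ∀ z ∈ Metric.ball (0 : EllNQ n q) 1, ‖f z‖ ≤ M) (m : ℕ) (z : EllNQ n q) :
    ‖∑ α ∈ Finset.piAntidiag Finset.univ m, (∏ j, z j ^ α j) • monomialCoeff f α‖ ≤
      M * ‖z‖ ^ m := by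
  rw [sum_monomialCoeff_eq_iteratedFDeriv hf, norm_smul, norm_inv, Complex.norm_natCast,
    inv_mul_le_iff₀ (by positivity), ← mul_assoc]
  exact norm_iteratedFDeriv_diag_le hf hM m z

end Expansion

/-! ### Coefficient estimates for scalar homogeneous polynomials -/

section Coefficients

/-- Cauchy's estimate on a torus, with the integral replaced by an average over a grid of roots of
unity. Order `m + 1` suffices: all exponents are at most `m`, so the characters of distinct
monomials are orthogonal on the grid. -/
theorem norm_coeff_mul_prod_le {n m : ℕ} (d : (Fin n → ℕ) → ℂ) (w : Fin n → ℝ)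
    (hw : ∀ i, 0 ≤ w i) {B : ℝ}
    (h : ∀ z : Fin n → ℂ, (∀ i, ‖z i‖ = w i) →
      ‖∑ α ∈ Finset.piAntidiag Finset.univ m, d α * ∏ i, z i ^ α i‖ ≤ B)
    {β : Fin n → ℕ} (hβ : β ∈ Finset.piAntidiag Finset.univ m) :
    ‖d β‖ * ∏ i, w i ^ β i ≤ B := by
  set ω : ℂ := Complex.exp (2 * Real.pi * Complex.I / (m + 1 : ℕ)) with hω
  have hprim : IsPrimitiveRoot ω (m + 1) := Complex.isPrimitiveRoot_exp _ (Nat.succ_ne_zero m)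
  have hω0 : ω ≠ 0 := Complex.exp_ne_zero _
  have hω1 : ‖ω‖ = 1 := hprim.norm'_eq_one (Nat.succ_ne_zero m)
  have hlt : ∀ α ∈ Finset.piAntidiag (Finset.univ : Finset (Fin n)) m, ∀ i, α i < m + 1 := by
    intro α hα i
    have := Finset.single_le_sum (f := α) (fun j _ => Nat.zero_le _) (Finset.mem_univ i)
    rw [(Finset.mem_piAntidiag.1 hα).1] at this
    omega
  have hsum : ∀ α ∈ Finset.piAntidiag (Finset.univ : Finset (Fin n)) m,
      ∑ g : Fin n → Fin (m + 1), ∏ i, (ω ^ α i / ω ^ β i) ^ (g i : ℕ) =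
        if α = β then ((m : ℂ) + 1) ^ n else 0 := by
    intro α hα
    have h1 := Finset.prod_univ_sum (fun _ : Fin n => (Finset.univ : Finset (Fin (m + 1))))
      (fun i j => (ω ^ α i / ω ^ β i) ^ (j : ℕ))
    rw [Fintype.piFinset_univ] at h1
    rw [← h1]
    split_ifs with hαβ
    · subst hαβ
      simp [hω0]
    · obtain ⟨i, hi⟩ := Function.ne_iff.1 hαβ
      refine Finset.prod_eq_zero (Finset.mem_univ i) ?_
      rw [Fin.sum_univ_eq_sum_range (fun j => (ω ^ α i / ω ^ β i) ^ j)]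
      rw [geom_sum_eq, div_pow, ← pow_mul, ← pow_mul, mul_comm, pow_mul, mul_comm, pow_mul,
        hprim.pow_eq_one]
      · simp
      · intro h2
        rw [div_eq_one_iff_eq (pow_ne_zero _ hω0)] at h2
        exact hi (hprim.pow_inj (hlt α hα i) (hlt β hβ i) h2)
  have hmain : ∑ g : Fin n → Fin (m + 1), (∏ i, (ω ^ β i)⁻¹ ^ (g i : ℕ)) *
      ∑ α ∈ Finset.piAntidiag Finset.univ m, d α * ∏ i, ((w i : ℂ) * ω ^ (g i : ℕ)) ^ α i =
      ((m : ℂ) + 1) ^ n * (d β * ∏ i, (w i : ℂ) ^ β i) := by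
    simp only [Finset.mul_sum]
    rw [Finset.sum_comm]
    have h3 : ∀ α ∈ Finset.piAntidiag (Finset.univ : Finset (Fin n)) m,
        ∑ g : Fin n → Fin (m + 1), (∏ i, (ω ^ β i)⁻¹ ^ (g i : ℕ)) *
          (d α * ∏ i, ((w i : ℂ) * ω ^ (g i : ℕ)) ^ α i) =
        if α = β then ((m : ℂ) + 1) ^ n * (d β * ∏ i, (w i : ℂ) ^ β i) else 0 := by
      intro α hα
      have h4 : ∀ g : Fin n → Fin (m + 1), (∏ i, (ω ^ β i)⁻¹ ^ (g i : ℕ)) *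
          (d α * ∏ i, ((w i : ℂ) * ω ^ (g i : ℕ)) ^ α i) =
          (d α * ∏ i, (w i : ℂ) ^ α i) * ∏ i, (ω ^ α i / ω ^ β i) ^ (g i : ℕ) := by
        intro g
        rw [mul_left_comm, mul_assoc, ← Finset.prod_mul_distrib, ← Finset.prod_mul_distrib]
        congr 1
        refine Finset.prod_congr rfl fun i _ => ?_
        rw [mul_pow, div_pow, div_eq_mul_inv, inv_pow, pow_right_comm ω]
        ring
      simp only [h4]
      rw [← Finset.mul_sum, hsum α hα]
      split_ifs with hαβ
      · rw [hαβ]; ring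
      · simp
    rw [Finset.sum_congr rfl h3, Finset.sum_ite_eq' _ β, if_pos hβ]
  have hle : ‖((m : ℂ) + 1) ^ n * (d β * ∏ i, (w i : ℂ) ^ β i)‖ ≤ ((m : ℝ) + 1) ^ n * B := by
    rw [← hmain]
    refine (norm_sum_le _ _).trans ?_
    have h5 : ∀ g ∈ (Finset.univ : Finset (Fin n → Fin (m + 1))),
        ‖(∏ i, (ω ^ β i)⁻¹ ^ (g i : ℕ)) *
          ∑ α ∈ Finset.piAntidiag Finset.univ m, d α * ∏ i, ((w i : ℂ) * ω ^ (g i : ℕ)) ^ α i‖ ≤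
          B := by
      intro g _
      rw [norm_mul, norm_prod]
      simp only [norm_pow, norm_inv, hω1, one_pow, inv_one, Finset.prod_const_one, one_mul]
      refine h _ fun i => ?_
      rw [norm_mul, norm_pow, hω1, one_pow, mul_one, Complex.norm_real, Real.norm_of_nonneg (hw i)]
    refine (Finset.sum_le_sum h5).trans (le_of_eq ?_)
    simp
  have hN : ‖((m : ℂ) + 1) ^ n‖ = ((m : ℝ) + 1) ^ n := by
    rw [norm_pow]
    congr 1
    exact_mod_cast Complex.norm_natCast (m + 1)
  rw [norm_mul, hN] at hle
  have h6 := le_of_mul_le_mul_left hle (by positivity)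
  rw [norm_mul, norm_prod] at h6
  simpa [Complex.norm_real, abs_of_nonneg, hw] using h6

/-- Substitute `α = β + e_i`; the weight `α i` kills the terms that are not of this form. -/
theorem sum_piAntidiag_succ_sum_smul {R : Type*} [AddCommMonoid R] {n k : ℕ}
    (H : (Fin n → ℕ) → Fin n → R) :
    ∑ α ∈ Finset.piAntidiag (Finset.univ : Finset (Fin n)) (k + 1), ∑ i, α i • H α i =
      ∑ β ∈ Finset.piAntidiag (Finset.univ : Finset (Fin n)) k, ∑ i,
        (β i + 1) • H (β + Pi.single i 1) i := by
  rw [Finset.sum_comm, Finset.sum_comm (s := Finset.piAntidiag _ k)]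
  refine Finset.sum_congr rfl fun i _ => ?_
  have h1 : ∑ α ∈ Finset.piAntidiag (Finset.univ : Finset (Fin n)) (k + 1), α i • H α i =
      ∑ α ∈ Finset.piAntidiag (Finset.univ : Finset (Fin n)) (k + 1) with α i ≠ 0, α i • H α i := by
    rw [Finset.sum_filter_of_ne]
    intro α _ h h0
    exact h (by rw [h0, zero_smul])
  rw [h1]
  have hcancel : ∀ α : Fin n → ℕ, α i ≠ 0 → α - Pi.single i 1 + Pi.single i 1 = α := by
    intro α hα
    ext j
    by_cases hj : j = i
    · subst hj; simp; omega
    · simp [hj]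
  symm
  refine Finset.sum_bij' (fun β _ => β + Pi.single i 1) (fun α _ => α - Pi.single i 1)
    ?_ ?_ ?_ ?_ ?_
  · intro β hβ
    rw [Finset.mem_piAntidiag] at hβ
    simp only [Finset.mem_filter, Finset.mem_piAntidiag, Pi.add_apply, Finset.sum_add_distrib,
      hβ.1]
    simp
  · intro α hα
    simp only [Finset.mem_filter, Finset.mem_piAntidiag] at hα
    rw [Finset.mem_piAntidiag]
    refine ⟨?_, fun _ _ => Finset.mem_univ _⟩
    have h2 := hα.1.1
    rw [← hcancel α hα.2] at h2
    simp only [Pi.add_apply, Finset.sum_add_distrib, Finset.sum_pi_single', Finset.mem_univ,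
      if_true] at h2
    exact Nat.succ_injective h2
  · intro β _
    simp
  · intro α hα
    exact hcancel α (Finset.mem_filter.1 hα).2
  · intro β _
    simp

theorem hasDerivAt_sum_coeff_mul_prod {n k : ℕ} (c : (Fin n → ℕ) → ℂ) (z u : Fin n → ℂ) :
    HasDerivAt (fun ζ : ℂ => ∑ α ∈ Finset.piAntidiag Finset.univ (k + 1),
        c α * ∏ i, (z i + ζ * u i) ^ α i)
      (∑ β ∈ Finset.piAntidiag Finset.univ k,
        (∑ i, ((β i : ℂ) + 1) * c (β + Pi.single i 1) * u i) * ∏ i, z i ^ β i) 0 := by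
  have h1 : ∀ α : Fin n → ℕ, HasDerivAt (fun ζ : ℂ => c α * ∏ i, (z i + ζ * u i) ^ α i)
      (∑ i, α i • (c α * u i * ((∏ j ∈ Finset.univ.erase i, z j ^ α j) * z i ^ (α i - 1)))) 0 := by
    intro α
    have h2 : ∀ i ∈ (Finset.univ : Finset (Fin n)), HasDerivAt (fun ζ : ℂ => (z i + ζ * u i) ^ α i)
        (α i * z i ^ (α i - 1) * u i) 0 := by
      intro i _
      have h3 : HasDerivAt (fun ζ : ℂ => z i + ζ * u i) (u i) 0 := by
        simpa using ((hasDerivAt_id (0 : ℂ)).mul_const (u i)).const_add (z i)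
      simpa using h3.fun_pow (α i)
    refine ((HasDerivAt.fun_finsetProd h2).const_mul (c α)).congr_deriv ?_
    rw [Finset.mul_sum]
    refine Finset.sum_congr rfl fun i _ => ?_
    simp only [zero_mul, add_zero, smul_eq_mul, nsmul_eq_mul]
    ring
  refine (HasDerivAt.fun_sum fun α _ => h1 α).congr_deriv ?_
  rw [sum_piAntidiag_succ_sum_smul]
  refine Finset.sum_congr rfl fun β _ => ?_
  rw [Finset.sum_mul]
  refine Finset.sum_congr rfl fun i _ => ?_
  have h4 : ∏ j ∈ Finset.univ.erase i, z j ^ (β + Pi.single i 1 : Fin n → ℕ) j =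
      ∏ j ∈ Finset.univ.erase i, z j ^ β j := by
    refine Finset.prod_congr rfl fun j hj => ?_
    simp [Finset.ne_of_mem_erase hj]
  rw [h4, ← Finset.prod_erase_mul _ _ (Finset.mem_univ i)]
  simp only [Pi.add_apply, Pi.single_eq_same, add_tsub_cancel_right, nsmul_eq_mul]
  push_cast
  ring

theorem norm_le_one_of_norm_eq_rpow {n : ℕ} {q : ℝ≥0∞} [Fact (1 ≤ q)] {a : Fin n → ℝ}
    (ha : ∀ i, 0 ≤ a i) (hsum : ∑ i, a i ≤ 1) (z : EllNQ n q)
    (hz : ∀ i, ‖z i‖ = a i ^ (1 / q).toReal) : ‖z‖ ≤ 1 := by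
  rcases eq_or_ne q ∞ with rfl | hq
  · rw [PiLp.norm_eq_ciSup]
    refine Real.iSup_le (fun i => ?_) zero_le_one
    -- Here the exponent is `0`, so every coordinate has modulus `1`, even where `a i = 0`.
    simp [hz]
  · have hq0 : 0 < q.toReal :=
      ENNReal.toReal_pos (zero_lt_one.trans_le Fact.out).ne' hq
    rw [PiLp.norm_eq_sum hq0]
    refine Real.rpow_le_one (Finset.sum_nonneg fun i _ => by positivity) ?_ (by positivity)
    refine le_trans (le_of_eq (Finset.sum_congr rfl fun i _ => ?_)) hsum
    rw [hz, ← Real.rpow_mul (ha i), one_div, ENNReal.toReal_inv, inv_mul_cancel₀ hq0.ne',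
      Real.rpow_one]

variable {n : ℕ} {q : ℝ≥0∞} [Fact (1 ≤ q)] {c : (Fin n → ℕ) → ℂ} {M : ℝ}

theorem norm_coeff_le {m : ℕ} (hn : 0 < n)
    (hc : ∀ z : EllNQ n q, ‖∑ α ∈ Finset.piAntidiag Finset.univ m, c α * ∏ i, z i ^ α i‖ ≤
      M * ‖z‖ ^ m) (hM : 0 ≤ M) {α : Fin n → ℕ} (hα : α ∈ Finset.piAntidiag Finset.univ m) :
    ‖c α‖ ≤ M * ((n : ℝ) ^ (1 / q).toReal) ^ m := by
  have hn' : (0 : ℝ) < n := by exact_mod_cast hn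
  have h1 := norm_coeff_mul_prod_le c (fun _ => ((n : ℝ)⁻¹) ^ (1 / q).toReal)
    (fun _ => by positivity) (B := M) (fun z hz => by
      refine (hc (WithLp.toLp q z)).trans ?_
      refine mul_le_of_le_one_right hM (pow_le_one₀ (norm_nonneg _) ?_)
      refine norm_le_one_of_norm_eq_rpow (a := fun _ => (n : ℝ)⁻¹) (fun _ => by positivity) ?_ _ hz
      simp [hn'.ne']) hα
  rw [Finset.prod_pow_eq_pow_sum, (Finset.mem_piAntidiag.1 hα).1, Real.inv_rpow hn'.le, inv_pow,
    ← div_eq_mul_inv, div_le_iff₀ (by positivity)] at h1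
  exact h1

theorem norm_sum_deriv_le {k : ℕ}
    (hc : ∀ z : EllNQ n q, ‖∑ α ∈ Finset.piAntidiag Finset.univ (k + 1), c α * ∏ i, z i ^ α i‖ ≤
      M * ‖z‖ ^ (k + 1)) (hM : 0 ≤ M) {z u : EllNQ n q} (hz : ‖z‖ ≤ 1) (hu : ‖u‖ ≤ 1) :
    ‖∑ β ∈ Finset.piAntidiag Finset.univ k,
        (∑ i, ((β i : ℂ) + 1) * c (β + Pi.single i 1) * u i) * ∏ i, z i ^ β i‖ ≤
      M * ((k + 1) * Real.exp 1) := by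
  rw [← (hasDerivAt_sum_coeff_mul_prod c z u).deriv]
  have hk : (0 : ℝ) < k + 1 := by positivity
  -- On the circle of this radius `‖z + ζ u‖ ≤ 1 + 1/(k+1)`, whose power `k + 1` is at most `e`.
  have hR : (0 : ℝ) < 1 / (k + 1) := by positivity
  refine (Complex.norm_deriv_le_of_forall_mem_sphere_norm_le (C := M * Real.exp 1) hR
    (Differentiable.diffContOnCl (by fun_prop)) ?_).trans (le_of_eq (by field_simp))
  intro ζ hζ
  rw [mem_sphere_zero_iff_norm] at hζ
  have h1 := hc (z + ζ • u)
  simp only [PiLp.add_apply, PiLp.smul_apply, smul_eq_mul] at h1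
  refine h1.trans (mul_le_mul_of_nonneg_left ?_ hM)
  have h2 : ‖z + ζ • u‖ ≤ Real.exp (1 / (k + 1)) := by
    refine (norm_add_le _ _).trans ?_
    rw [norm_smul, hζ]
    have h3 : 1 / ((k : ℝ) + 1) * ‖u‖ ≤ 1 / (k + 1) := mul_le_of_le_one_right hR.le hu
    linarith [Real.add_one_le_exp (1 / ((k : ℝ) + 1))]
  refine (pow_le_pow_left₀ (norm_nonneg _) h2 _).trans (le_of_eq ?_)
  rw [← Real.exp_nat_mul]
  congr 1
  push_cast
  field_simp

theorem sum_norm_coeff_mul_prod_le {k : ℕ} (hn : 0 < n)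
    (hc : ∀ z : EllNQ n q, ‖∑ α ∈ Finset.piAntidiag Finset.univ (k + 1), c α * ∏ i, z i ^ α i‖ ≤
      M * ‖z‖ ^ (k + 1)) (hM : 0 ≤ M) {a : Fin n → ℝ} (ha : ∀ i, 0 ≤ a i) (hsum : ∑ i, a i ≤ 1)
    {β : Fin n → ℕ} (hβ : β ∈ Finset.piAntidiag Finset.univ k) :
    (∑ i, (β i + 1) • ‖c (β + Pi.single i 1)‖) * ∏ i, (a i ^ (1 / q).toReal) ^ β i ≤
      M * ((k + 1) * Real.exp 1) * (n : ℝ) ^ (1 / q).toReal := by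
  have hn' : (0 : ℝ) < n := by exact_mod_cast hn
  set s := (1 / q).toReal with hs
  have hphase : ∀ x : ℂ, ∃ y : ℂ, ‖y‖ = 1 ∧ x * y = ‖x‖ := by
    intro x
    rcases eq_or_ne x 0 with rfl | hx
    · exact ⟨1, by simp⟩
    · refine ⟨‖x‖ / x, ?_, mul_div_cancel₀ _ hx⟩
      rw [norm_div, Complex.norm_real, norm_norm, div_self (norm_ne_zero_iff.2 hx)]
  choose y hy1 hy2 using hphase
  -- The phases make the `β` coefficient of the derivative along `u` equal to `n^{-1/q}` times a sum
  -- of absolute values.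
  set u : EllNQ n q :=
    WithLp.toLp q fun i => (((n : ℝ)⁻¹ ^ s : ℝ) : ℂ) * y (c (β + Pi.single i 1)) with hu
  have hu1 : ‖u‖ ≤ 1 := by
    refine norm_le_one_of_norm_eq_rpow (a := fun _ => (n : ℝ)⁻¹) (fun _ => by positivity) ?_ _ ?_
    · simp [hn'.ne']
    · intro i
      simp only [hu]
      rw [norm_mul, hy1, mul_one, Complex.norm_real, Real.norm_of_nonneg (by positivity)]
  have h1 := norm_coeff_mul_prod_le
    (fun β => ∑ i, ((β i : ℂ) + 1) * c (β + Pi.single i 1) * u i) (fun i => a i ^ s)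
    (fun i => Real.rpow_nonneg (ha i) _) (B := M * ((k + 1) * Real.exp 1)) (fun z hz =>
      norm_sum_deriv_le hc hM (norm_le_one_of_norm_eq_rpow ha hsum (WithLp.toLp q z) hz) hu1) hβ
  have h2 : (∑ i, ((β i : ℂ) + 1) * c (β + Pi.single i 1) * u i) =
      (((n : ℝ)⁻¹ ^ s * ∑ i, (β i + 1) • ‖c (β + Pi.single i 1)‖ : ℝ) : ℂ) := by
    push_cast
    rw [Finset.mul_sum]
    refine Finset.sum_congr rfl fun i _ => ?_
    simp only [hu, nsmul_eq_mul]
    rw [← hy2]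
    push_cast
    ring
  simp only at h1
  rw [h2, Complex.norm_real, Real.norm_of_nonneg
    (mul_nonneg (by positivity) (Finset.sum_nonneg fun i _ => by positivity)),
    Real.inv_rpow hn'.le, mul_assoc, inv_mul_le_iff₀ (by positivity)] at h1
  linarith

/-- Each `β` gets its own torus, of radii `(β_i/k)^{1/q}`. The factor `k + 1` from Cauchy's estimate
cancels against `∑ α_i = k + 1`. For `k = 0` the conventions `0 / 0 = 0` and `0 ^ 0 = 1` give the
empty product. -/
theorem sum_norm_coeff_le_sum_inv_prod {k : ℕ} (hn : 0 < n)
    (hc : ∀ z : EllNQ n q, ‖∑ α ∈ Finset.piAntidiag Finset.univ (k + 1), c α * ∏ i, z i ^ α i‖ ≤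
      M * ‖z‖ ^ (k + 1)) (hM : 0 ≤ M) :
    ∑ α ∈ Finset.piAntidiag (Finset.univ : Finset (Fin n)) (k + 1), ‖c α‖ ≤
      M * Real.exp 1 * (n : ℝ) ^ (1 / q).toReal *
        ∑ β ∈ Finset.piAntidiag (Finset.univ : Finset (Fin n)) k,
          ((∏ i, ((β i : ℝ) / k) ^ β i)⁻¹) ^ (1 / q).toReal := by
  have hk : (0 : ℝ) < k + 1 := by positivity
  have h1 : ((k : ℝ) + 1) * ∑ α ∈ Finset.piAntidiag (Finset.univ : Finset (Fin n)) (k + 1), ‖c α‖ =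
      ∑ β ∈ Finset.piAntidiag (Finset.univ : Finset (Fin n)) k,
        ∑ i, (β i + 1) • ‖c (β + Pi.single i 1)‖ := by
    rw [← sum_piAntidiag_succ_sum_smul (fun α _ => ‖c α‖), Finset.mul_sum]
    refine Finset.sum_congr rfl fun α hα => ?_
    rw [← Finset.sum_smul, (Finset.mem_piAntidiag.1 hα).1, nsmul_eq_mul]
    push_cast
    rfl
  refine le_of_mul_le_mul_left ?_ hk
  rw [h1, Finset.mul_sum, Finset.mul_sum]
  refine Finset.sum_le_sum fun β hβ => ?_
  have hβs := (Finset.mem_piAntidiag.1 hβ).1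
  have ha : ∀ i, (0 : ℝ) ≤ (β i : ℝ) / k := fun i => by positivity
  have h2 := sum_norm_coeff_mul_prod_le hn hc hM ha (by
    rw [← Finset.sum_div, ← Nat.cast_sum, hβs]
    exact div_self_le_one _) hβ
  have h3 : ∏ i, (((β i : ℝ) / k) ^ (1 / q).toReal) ^ β i =
      (∏ i, ((β i : ℝ) / k) ^ β i) ^ (1 / q).toReal := by
    rw [← Real.finsetProd_rpow _ _ fun i _ => pow_nonneg (ha i) _]
    refine Finset.prod_congr rfl fun i _ => ?_
    rw [← Real.rpow_natCast, ← Real.rpow_mul (ha i), mul_comm, Real.rpow_mul (ha i),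
      Real.rpow_natCast]
  have h4 : 0 < ∏ i, ((β i : ℝ) / k) ^ β i := by
    refine Finset.prod_pos fun i _ => ?_
    rcases Nat.eq_zero_or_pos (β i) with h | h
    · simp [h]
    · have : 0 < k := by
        rw [← hβs]
        exact h.trans_le (Finset.single_le_sum (f := β) (fun _ _ => Nat.zero_le _)
          (Finset.mem_univ i))
      positivity
  rw [h3] at h2
  rw [Real.inv_rpow h4.le, ← mul_assoc, ← div_eq_mul_inv, le_div_iff₀ (by positivity)]
  linarith

end Coefficients

/-! ### Counting multi-indices and the logarithmic gain -/

section Numeric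

theorem card_piAntidiag_univ_fin (n k : ℕ) :
    (Finset.piAntidiag (Finset.univ : Finset (Fin n)) k).card = (n + k - 1).choose k := by
  rw [← Finset.map_sym_eq_piAntidiag, Finset.card_map, Finset.sym_univ, Finset.card_univ,
    Sym.card_sym_eq_choose, Fintype.card_fin]

theorem choose_mul_log_pow_le {n : ℕ} (hn : 1 < n) (k : ℕ) :
    ((n + k - 1).choose k : ℝ) * Real.log n ^ (k + 1) ≤
      (2 * Real.exp 1) ^ k * (n : ℝ) ^ (k + 1) := by
  have hn' : (1 : ℝ) < n := by exact_mod_cast hn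
  have hL : 0 ≤ Real.log n := Real.log_nonneg hn'.le
  have he : (2 : ℝ) ≤ Real.exp 1 := by linarith [Real.add_one_le_exp (1 : ℝ)]
  have hLn : Real.log n ≤ n := (Real.log_le_sub_one_of_pos (by linarith)).trans (by linarith)
  -- For `k < n` the factorial in the binomial absorbs `(log n)^{k+1} ≤ (k+1)! n`. For `k ≥ n` the
  -- binomial is at most `4^k`, and `log n ≤ n` suffices.
  rcases lt_or_ge k n with hk | hk
  · have h1 : Real.log n ^ (k + 1) ≤ (k + 1)! * n := by
      have h2 := Real.pow_div_factorial_le_exp _ hL (k + 1)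
      rw [Real.exp_log (by linarith), div_le_iff₀ (by positivity)] at h2
      linarith
    have h3 : ((n + k - 1).choose k : ℝ) * k ! ≤ (2 * n) ^ k := by
      have h4 : (n + k - 1).choose k * k ! ≤ (2 * n) ^ k := by
        rw [mul_comm, ← Nat.descFactorial_eq_factorial_mul_choose]
        exact (Nat.descFactorial_le_pow _ _).trans (Nat.pow_le_pow_left (by omega) k)
      exact_mod_cast h4
    have h5 : (k : ℝ) + 1 ≤ 2 ^ k := by exact_mod_cast Nat.lt_two_pow_self
    calc ((n + k - 1).choose k : ℝ) * Real.log n ^ (k + 1)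
        ≤ ((n + k - 1).choose k : ℝ) * ((k + 1)! * n) := by gcongr
      _ = (((n + k - 1).choose k : ℝ) * k !) * (k + 1) * n := by
        rw [Nat.factorial_succ]; push_cast; ring
      _ ≤ (2 * n) ^ k * 2 ^ k * n := by gcongr
      _ = (2 * 2) ^ k * (n : ℝ) ^ (k + 1) := by rw [mul_pow, mul_pow]; ring
      _ ≤ (2 * Real.exp 1) ^ k * (n : ℝ) ^ (k + 1) := by gcongr
  · have h1 : ((n + k - 1).choose k : ℝ) ≤ (2 * 2) ^ k := by
      have h2 : (n + k - 1).choose k ≤ (2 * 2) ^ k := by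
        refine (Nat.choose_le_two_pow _ _).trans ?_
        rw [mul_pow, ← pow_add]
        exact Nat.pow_le_pow_right two_pos (by omega)
      exact_mod_cast h2
    have h3 : ((2 : ℝ) * 2) ^ k ≤ (2 * Real.exp 1) ^ k := by gcongr
    exact mul_le_mul (h1.trans h3) (pow_le_pow_left₀ hL hLn _) (by positivity) (by positivity)

/-- Combine `k^k ≤ e^k k!` with `β_i! ≤ β_i^{β_i}`. -/
theorem inv_prod_div_pow_le {n k : ℕ} {β : Fin n → ℕ}
    (hβ : β ∈ Finset.piAntidiag Finset.univ k) :
    (∏ i, ((β i : ℝ) / k) ^ β i)⁻¹ ≤ Real.exp k * Nat.multinomial Finset.univ β := by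
  have hs := (Finset.mem_piAntidiag.1 hβ).1
  have h1 : ∏ i, ((β i : ℝ) / k) ^ β i = (∏ i, (β i : ℝ) ^ β i) / (k : ℝ) ^ k := by
    simp only [div_pow]
    rw [Finset.prod_div_distrib, Finset.prod_pow_eq_pow_sum, hs]
  have h2 := Real.pow_div_factorial_le_exp (k : ℝ) (by positivity) k
  have h3 : (∏ i, ((β i)! : ℝ)) * Nat.multinomial Finset.univ β = k ! := by
    have := Nat.multinomial_spec Finset.univ β
    rw [hs] at this
    exact_mod_cast this
  have h4 : (∏ i, ((β i)! : ℝ)) ≤ ∏ i, (β i : ℝ) ^ β i :=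
    Finset.prod_le_prod (fun i _ => by positivity) fun i _ => by
      exact_mod_cast Nat.factorial_le_pow (β i)
  have h5 : 0 < ∏ i, ((β i)! : ℝ) :=
    Finset.prod_pos fun i _ => by exact_mod_cast Nat.factorial_pos _
  rw [h1, inv_div, div_le_iff₀ (h5.trans_le h4)]
  rw [div_le_iff₀ (by positivity)] at h2
  calc (k : ℝ) ^ k ≤ Real.exp k * k ! := h2
    _ = Real.exp k * Nat.multinomial Finset.univ β * ∏ i, ((β i)! : ℝ) := by rw [← h3]; ring
    _ ≤ _ := by gcongr

/-- Hölder's inequality, obtained by summing weighted AM-GM for the pairs `a i / A`, `1 / t.card`.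
-/
theorem sum_rpow_le_rpow_mul_card_rpow {ι : Type*} (t : Finset ι) {a : ι → ℝ}
    (ha : ∀ i ∈ t, 0 ≤ a i) {s : ℝ} (hs0 : 0 ≤ s) (hs1 : s ≤ 1) (hA : 0 < ∑ i ∈ t, a i) :
    ∑ i ∈ t, a i ^ s ≤ (∑ i ∈ t, a i) ^ s * (t.card : ℝ) ^ (1 - s) := by
  set A := ∑ i ∈ t, a i with hAdef
  have hN : (0 : ℝ) < t.card := by
    have : t.Nonempty := Finset.nonempty_of_sum_ne_zero hA.ne'
    exact_mod_cast this.card_pos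
  have h1 : ∀ i ∈ t, a i ^ s ≤
      A ^ s * (t.card : ℝ) ^ (1 - s) * (s * (a i / A) + (1 - s) * (1 / t.card)) := by
    intro i hi
    have h2 := Real.geom_mean_le_arith_mean2_weighted hs0 (sub_nonneg.2 hs1)
      (div_nonneg (ha i hi) hA.le) (by positivity : (0 : ℝ) ≤ 1 / t.card) (by ring)
    rw [Real.div_rpow (ha i hi) hA.le, Real.div_rpow zero_le_one hN.le, Real.one_rpow,
      div_mul_div_comm, mul_one, div_le_iff₀ (by positivity)] at h2
    linarith
  refine (Finset.sum_le_sum h1).trans (le_of_eq ?_)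
  rw [← Finset.mul_sum, Finset.sum_add_distrib, ← Finset.mul_sum, ← Finset.sum_div, ← hAdef,
    Finset.sum_const, nsmul_eq_mul, div_self hA.ne', mul_left_comm, mul_one_div_cancel hN.ne']
  ring

theorem sum_norm_coeff_le {n : ℕ} {q : ℝ≥0∞} [Fact (1 ≤ q)] {c : (Fin n → ℕ) → ℂ} {M : ℝ} {k : ℕ}
    (hn : 1 < n)
    (hc : ∀ z : EllNQ n q, ‖∑ α ∈ Finset.piAntidiag Finset.univ (k + 1), c α * ∏ i, z i ^ α i‖ ≤
      M * ‖z‖ ^ (k + 1)) (hM : 0 ≤ M) :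
    (∑ α ∈ Finset.piAntidiag (Finset.univ : Finset (Fin n)) (k + 1), ‖c α‖) *
        (Real.exp (-1) * Real.log n ^ (1 - (1 / q).toReal) / n) ^ (k + 1) ≤ M * 2 ^ k := by
  set s := (1 / q).toReal with hs
  have hs0 : 0 ≤ s := ENNReal.toReal_nonneg
  have hs1 : s ≤ 1 := by
    refine ENNReal.toReal_le_of_le_ofReal zero_le_one ?_
    rw [ENNReal.ofReal_one, one_div]
    exact ENNReal.inv_le_one.2 Fact.out
  have hn' : (1 : ℝ) < n := by exact_mod_cast hn
  have hn0 : (0 : ℝ) < n := by linarith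
  have hL : 0 < Real.log n := Real.log_pos hn'
  set N : ℝ := ((n + k - 1).choose k : ℝ) with hN
  have hNpos : 0 < N := by
    rw [hN]
    exact_mod_cast Nat.choose_pos (by omega)
  have hmul : ∑ β ∈ Finset.piAntidiag (Finset.univ : Finset (Fin n)) k,
      (Nat.multinomial Finset.univ β : ℝ) = (n : ℝ) ^ k := by
    have := Finset.sum_pow_eq_sum_piAntidiag (Finset.univ : Finset (Fin n)) (fun _ => (1 : ℝ)) k
    simpa using this.symm
  have h1 : ∑ β ∈ Finset.piAntidiag (Finset.univ : Finset (Fin n)) k,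
      ((∏ i, ((β i : ℝ) / k) ^ β i)⁻¹) ^ s ≤
      Real.exp k ^ s * (((n : ℝ) ^ k) ^ s * N ^ (1 - s)) := by
    have h2 : ∀ β ∈ Finset.piAntidiag (Finset.univ : Finset (Fin n)) k,
        ((∏ i, ((β i : ℝ) / k) ^ β i)⁻¹) ^ s ≤
          Real.exp k ^ s * (Nat.multinomial Finset.univ β : ℝ) ^ s := by
      intro β hβ
      rw [← Real.mul_rpow (Real.exp_pos _).le (by positivity)]
      exact Real.rpow_le_rpow
        (inv_nonneg.2 (Finset.prod_nonneg fun i _ => by positivity)) (inv_prod_div_pow_le hβ) hs0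
    refine (Finset.sum_le_sum h2).trans ?_
    rw [← Finset.mul_sum, ← hmul, hN, ← card_piAntidiag_univ_fin]
    refine mul_le_mul_of_nonneg_left
      (sum_rpow_le_rpow_mul_card_rpow _ (fun _ _ => by positivity) hs0 hs1 ?_) (by positivity)
    rw [hmul]
    positivity
  have h3 := (sum_norm_coeff_le_sum_inv_prod (by omega) hc hM).trans
    (mul_le_mul_of_nonneg_left h1 (by positivity))
  -- The bound is a geometric mean, with weights `s` and `1 - s`, of its values at `s = 1` and `s =
  -- 0`. These are at most `T` and `T / (log n)^{k+1}`.
  set T : ℝ := 2 ^ k * (Real.exp 1 * n) ^ (k + 1) with hT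
  have hTpos : 0 < T := by positivity
  have hA : Real.exp 1 * n * Real.exp k * (n : ℝ) ^ k ≤ T := by
    have h4 : Real.exp k = Real.exp 1 ^ k := by rw [← Real.exp_nat_mul, mul_one]
    have h5 : Real.exp 1 * n * Real.exp k * (n : ℝ) ^ k = 1 * (Real.exp 1 * n) ^ (k + 1) := by
      rw [h4, mul_pow]; ring
    rw [h5, hT]
    gcongr
    exact one_le_pow₀ one_le_two
  have hB : Real.exp 1 * N ≤ T / Real.log n ^ (k + 1) := by
    rw [le_div_iff₀ (by positivity)]
    have h6 := mul_le_mul_of_nonneg_left (choose_mul_log_pow_le hn k) (Real.exp_pos 1).le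
    calc Real.exp 1 * N * Real.log n ^ (k + 1)
        = Real.exp 1 * (N * Real.log n ^ (k + 1)) := by ring
      _ ≤ _ := h6
      _ = T := by rw [hT, mul_pow, mul_pow]; ring
  have h7 : Real.exp 1 * (n : ℝ) ^ s * (Real.exp k ^ s * (((n : ℝ) ^ k) ^ s * N ^ (1 - s))) ≤
      T / (Real.log n ^ (k + 1)) ^ (1 - s) := by
    have h8 : Real.exp 1 * (n : ℝ) ^ s * (Real.exp k ^ s * (((n : ℝ) ^ k) ^ s * N ^ (1 - s))) =
        (Real.exp 1 * n * Real.exp k * (n : ℝ) ^ k) ^ s * (Real.exp 1 * N) ^ (1 - s) := by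
      rw [Real.mul_rpow (by positivity) (by positivity), Real.mul_rpow (by positivity)
        (by positivity), Real.mul_rpow (by positivity) (by positivity), Real.mul_rpow
        (by positivity) (by positivity)]
      have h9 : Real.exp 1 = Real.exp 1 ^ s * Real.exp 1 ^ (1 - s) := by
        rw [← Real.rpow_add (Real.exp_pos 1)]; simp
      calc _ = (Real.exp 1 ^ s * Real.exp 1 ^ (1 - s)) * (n : ℝ) ^ s *
            (Real.exp k ^ s * (((n : ℝ) ^ k) ^ s * N ^ (1 - s))) := by rw [← h9]
        _ = _ := by ring
    rw [h8]
    calc _ ≤ T ^ s * (T / Real.log n ^ (k + 1)) ^ (1 - s) := by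
          gcongr
      _ = T ^ s * T ^ (1 - s) / (Real.log n ^ (k + 1)) ^ (1 - s) := by
          rw [Real.div_rpow hTpos.le (by positivity), mul_div_assoc]
      _ = _ := by rw [← Real.rpow_add hTpos]; simp
  have h10 : (∑ α ∈ Finset.piAntidiag (Finset.univ : Finset (Fin n)) (k + 1), ‖c α‖) ≤
      M * (T / (Real.log n ^ (k + 1)) ^ (1 - s)) := by
    refine h3.trans ?_
    calc _ = M * (Real.exp 1 * (n : ℝ) ^ s *
          (Real.exp k ^ s * (((n : ℝ) ^ k) ^ s * N ^ (1 - s)))) := by ring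
      _ ≤ _ := by gcongr
  refine (mul_le_mul_of_nonneg_right h10 (by positivity)).trans (le_of_eq ?_)
  have h11 : (Real.log n ^ (k + 1)) ^ (1 - s) = (Real.log n ^ (1 - s)) ^ (k + 1) := by
    rw [← Real.rpow_natCast, ← Real.rpow_natCast, ← Real.rpow_mul hL.le, ← Real.rpow_mul hL.le,
      mul_comm]
  have hL' : 0 < Real.log n ^ (1 - s) := by positivity
  rw [h11, hT, Real.exp_neg, div_pow, mul_pow, mul_pow, inv_pow]
  field_simp

end Numeric

/-! ### The summing norm of the identity -/

section Summing

variable {X : Type*} [NormedAddCommGroup X] [NormedSpace ℂ X]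

theorem isSummingConstant_one_one_id_iff {c : ℝ} :
    IsSummingConstant 1 1 (ContinuousLinearMap.id ℂ X) c ↔ ∀ (k : ℕ) (x : Fin k → X),
      ∑ j, ‖x j‖ ≤ c * ⨆ g : Metric.ball (0 : X →L[ℂ] ℂ) 1, ∑ j, ‖(g : X →L[ℂ] ℂ) (x j)‖ := by
  simp [IsSummingConstant]

theorem norm_apply_le_of_mem_ball (g : Metric.ball (0 : X →L[ℂ] ℂ) 1) (x : X) :
    ‖(g : X →L[ℂ] ℂ) x‖ ≤ ‖x‖ := by
  have hg : ‖(g : X →L[ℂ] ℂ)‖ ≤ 1 := (mem_ball_zero_iff.1 g.2).le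
  exact ((g : X →L[ℂ] ℂ).le_opNorm x).trans (mul_le_of_le_one_left (norm_nonneg x) hg)

theorem bddAbove_range_sum_norm_apply {k : ℕ} (x : Fin k → X) :
    BddAbove (Set.range fun g : Metric.ball (0 : X →L[ℂ] ℂ) 1 =>
      ∑ j, ‖(g : X →L[ℂ] ℂ) (x j)‖) := by
  refine ⟨∑ j, ‖x j‖, ?_⟩
  rintro _ ⟨g, rfl⟩
  exact Finset.sum_le_sum fun j _ => norm_apply_le_of_mem_ball g (x j)

instance nonempty_ball_dual : Nonempty (Metric.ball (0 : X →L[ℂ] ℂ) 1) := ⟨⟨0, Metric.mem_ball_self one_pos⟩⟩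

/-- Expand in a basis and test with the coordinate functionals. This makes the set defining
`summingNorm` nonempty, so that its infimum is meaningful. -/
theorem exists_isSummingConstant_one_one_id [FiniteDimensional ℂ X] :
    ∃ c : ℝ, 0 < c ∧ IsSummingConstant 1 1 (ContinuousLinearMap.id ℂ X) c := by
  set b := Module.finBasis ℂ X with hb
  set ψ : Fin (Module.finrank ℂ X) → X →L[ℂ] ℂ :=
    fun i => LinearMap.toContinuousLinearMap (b.coord i) with hψ
  refine ⟨1 + ∑ i, ‖b i‖ * (‖ψ i‖ + 1), by positivity, ?_⟩
  rw [isSummingConstant_one_one_id_iff]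
  intro k x
  set S := ⨆ g : Metric.ball (0 : X →L[ℂ] ℂ) 1, ∑ j, ‖(g : X →L[ℂ] ℂ) (x j)‖ with hS
  have hS0 : 0 ≤ S := Real.iSup_nonneg fun g => by positivity
  have h1 : ∀ i, ∑ j, ‖ψ i (x j)‖ ≤ (‖ψ i‖ + 1) * S := by
    intro i
    have hpos : 0 < ‖ψ i‖ + 1 := by positivity
    -- The supremum runs over the open dual ball, hence the normalisation by `‖ψ i‖ + 1`.
    have hmem : ((‖ψ i‖ + 1 : ℝ) : ℂ)⁻¹ • ψ i ∈ Metric.ball (0 : X →L[ℂ] ℂ) 1 := by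
      rw [mem_ball_zero_iff, norm_smul, norm_inv, Complex.norm_real, Real.norm_of_nonneg hpos.le,
        inv_mul_lt_iff₀ hpos]
      linarith
    have h2 := le_ciSup (bddAbove_range_sum_norm_apply x) ⟨_, hmem⟩
    simp only [smul_apply, norm_smul, norm_inv, Complex.norm_real,
      Real.norm_of_nonneg hpos.le] at h2
    rw [← Finset.mul_sum, inv_mul_le_iff₀ hpos] at h2
    exact h2
  have h3 : ∀ j, ‖x j‖ ≤ ∑ i, ‖b i‖ * ‖ψ i (x j)‖ := by
    intro j
    conv_lhs => rw [← b.sum_repr (x j)]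
    refine (norm_sum_le _ _).trans (Finset.sum_le_sum fun i _ => ?_)
    rw [norm_smul, mul_comm]
    rfl
  calc ∑ j, ‖x j‖ ≤ ∑ j, ∑ i, ‖b i‖ * ‖ψ i (x j)‖ := Finset.sum_le_sum fun j _ => h3 j
    _ = ∑ i, ‖b i‖ * ∑ j, ‖ψ i (x j)‖ := by
      rw [Finset.sum_comm]
      simp only [Finset.mul_sum]
    _ ≤ ∑ i, ‖b i‖ * ((‖ψ i‖ + 1) * S) := by gcongr with i; exact h1 i
    _ = (∑ i, ‖b i‖ * (‖ψ i‖ + 1)) * S := by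
      rw [Finset.sum_mul]
      simp only [mul_assoc]
    _ ≤ _ := by gcongr; linarith

theorem one_le_of_isSummingConstant_one_one_id [Nontrivial X] {c : ℝ} (hc0 : 0 < c)
    (hc : IsSummingConstant 1 1 (ContinuousLinearMap.id ℂ X) c) : 1 ≤ c := by
  obtain ⟨x, hx⟩ := exists_ne (0 : X)
  have h1 := isSummingConstant_one_one_id_iff.1 hc 1 fun _ => x
  simp only [Finset.univ_unique, Finset.sum_const, Finset.card_singleton, one_smul] at h1
  have h2 : ⨆ g : Metric.ball (0 : X →L[ℂ] ℂ) 1, ‖(g : X →L[ℂ] ℂ) x‖ ≤ ‖x‖ :=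
    ciSup_le fun g => norm_apply_le_of_mem_ball g x
  have h3 : 1 * ‖x‖ ≤ c * ‖x‖ := by
    rw [one_mul]
    exact h1.trans (mul_le_mul_of_nonneg_left h2 hc0.le)
  exact le_of_mul_le_mul_right h3 (norm_pos_iff.2 hx)

theorem one_le_summingNorm_one_one_id [FiniteDimensional ℂ X] [Nontrivial X] :
    1 ≤ summingNorm 1 1 (ContinuousLinearMap.id ℂ X) :=
  le_csInf exists_isSummingConstant_one_one_id fun _ hc =>
    one_le_of_isSummingConstant_one_one_id hc.1 hc.2

theorem sum_norm_le_summingNorm_mul [FiniteDimensional ℂ X] {ι : Type*} (t : Finset ι) (x : ι → X)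
    {B : ℝ} (hB : ∀ g : X →L[ℂ] ℂ, ‖g‖ ≤ 1 → ∑ j ∈ t, ‖g (x j)‖ ≤ B) :
    ∑ j ∈ t, ‖x j‖ ≤ summingNorm 1 1 (ContinuousLinearMap.id ℂ X) * B := by
  have hB0 : 0 ≤ B := by simpa using hB 0 (by simp)
  have h1 : ∀ c ∈ {c : ℝ | 0 < c ∧ IsSummingConstant 1 1 (ContinuousLinearMap.id ℂ X) c},
      ∑ j ∈ t, ‖x j‖ ≤ c * B := by
    rintro c ⟨hc0, hc⟩
    have h2 := isSummingConstant_one_one_id_iff.1 hc t.card fun k => x (t.equivFin.symm k)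
    have h3 : ∀ F : ι → ℝ, ∑ k, F (t.equivFin.symm k) = ∑ j ∈ t, F j := by
      intro F
      rw [t.equivFin.symm.sum_comp fun j : t => F j, Finset.sum_coe_sort]
    rw [h3 fun j => ‖x j‖] at h2
    refine h2.trans (mul_le_mul_of_nonneg_left (ciSup_le fun g => ?_) hc0.le)
    rw [h3 fun j => ‖(g : X →L[ℂ] ℂ) (x j)‖]
    exact hB g (mem_ball_zero_iff.1 g.2).le
  rcases hB0.eq_or_lt with h0 | h0
  · obtain ⟨c, hc⟩ := exists_isSummingConstant_one_one_id (X := X)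
    simpa [← h0] using h1 c hc
  · rw [← div_le_iff₀ h0]
    exact le_csInf exists_isSummingConstant_one_one_id fun c hc => (div_le_iff₀ h0).2 (h1 c hc)

end Summing

/-! ### Vector-valued homogeneous parts and the power `p` -/

section HomogeneousPart

variable {X : Type*} [NormedAddCommGroup X] [NormedSpace ℂ X] [FiniteDimensional ℂ X]
  {n : ℕ} {q : ℝ≥0∞} [Fact (1 ≤ q)] {f : EllNQ n q → X} {M : ℝ}

theorem norm_sum_apply_monomialCoeff_le (hf : DifferentiableOn ℂ f (Metric.ball 0 1))
    (hM : ∀ z ∈ Metric.ball (0 : EllNQ n q) 1, ‖f z‖ ≤ M) (m : ℕ) {g : X →L[ℂ] ℂ}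
    (hg : ‖g‖ ≤ 1) (z : EllNQ n q) :
    ‖∑ α ∈ Finset.piAntidiag Finset.univ m, g (monomialCoeff f α) * ∏ i, z i ^ α i‖ ≤
      M * ‖z‖ ^ m := by
  have h1 : ∑ α ∈ Finset.piAntidiag Finset.univ m, g (monomialCoeff f α) * ∏ i, z i ^ α i =
      g (∑ α ∈ Finset.piAntidiag Finset.univ m, (∏ j, z j ^ α j) • monomialCoeff f α) := by
    rw [map_sum]
    refine Finset.sum_congr rfl fun α _ => ?_
    rw [map_smul, smul_eq_mul, mul_comm]
  rw [h1]
  refine (g.le_opNorm _).trans ((mul_le_of_le_one_left (norm_nonneg _) hg).trans ?_)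
  exact norm_sum_monomialCoeff_le hf hM m z

theorem norm_monomialCoeff_le (hn : 0 < n) (hf : DifferentiableOn ℂ f (Metric.ball 0 1))
    (hM : ∀ z ∈ Metric.ball (0 : EllNQ n q) 1, ‖f z‖ ≤ M) (hM0 : 0 ≤ M) {m : ℕ} {α : Fin n → ℕ}
    (hα : α ∈ Finset.piAntidiag Finset.univ m) :
    ‖monomialCoeff f α‖ ≤ M * ((n : ℝ) ^ (1 / q).toReal) ^ m := by
  obtain ⟨g, hg, hgx⟩ := exists_dual_vector'' ℂ (monomialCoeff f α)
  have h1 := norm_coeff_le hn (fun z => norm_sum_apply_monomialCoeff_le hf hM m hg z) hM0 hα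
  rw [hgx] at h1
  simpa using h1

theorem sum_norm_monomialCoeff_le (hn : 1 < n) (hf : DifferentiableOn ℂ f (Metric.ball 0 1))
    (hM : ∀ z ∈ Metric.ball (0 : EllNQ n q) 1, ‖f z‖ ≤ M) (hM0 : 0 ≤ M) (k : ℕ) :
    (∑ α ∈ Finset.piAntidiag (Finset.univ : Finset (Fin n)) (k + 1), ‖monomialCoeff f α‖) *
        (Real.exp (-1) * Real.log n ^ (1 - (1 / q).toReal) / n) ^ (k + 1) ≤
      summingNorm 1 1 (ContinuousLinearMap.id ℂ X) * (M * 2 ^ k) := by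
  have hL : 0 < Real.log n := Real.log_pos (by exact_mod_cast hn)
  have hn0 : (0 : ℝ) < n := by exact_mod_cast (by omega : 0 < n)
  set σ := (Real.exp (-1) * Real.log n ^ (1 - (1 / q).toReal) / n) ^ (k + 1) with hσ
  have hσ0 : 0 < σ := by positivity
  rw [← le_div_iff₀ hσ0, mul_div_assoc]
  refine sum_norm_le_summingNorm_mul _ _ fun g hg => ?_
  rw [le_div_iff₀ hσ0]
  exact sum_norm_coeff_le hn (fun z => norm_sum_apply_monomialCoeff_le hf hM (k + 1) hg z) hM0

theorem Real.rpow_eq_self_mul_rpow_sub_one {x p : ℝ} (hx : 0 ≤ x) (hp : 1 ≤ p) :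
    x ^ p = x * x ^ (p - 1) := by
  rcases hx.eq_or_lt with rfl | hx
  · rw [Real.zero_rpow (by linarith), zero_mul]
  · rw [← Real.rpow_one_add' hx.le (by linarith)]
    congr 1
    ring

theorem sum_norm_monomialCoeff_rpow_le (hn : 1 < n) (hf : DifferentiableOn ℂ f (Metric.ball 0 1))
    (hM : ∀ z ∈ Metric.ball (0 : EllNQ n q) 1, ‖f z‖ ≤ M) (hM0 : 0 ≤ M) (k : ℕ) {p C t : ℝ}
    (hp : 1 ≤ p) (hC0 : 0 ≤ C) (hC1 : C ≤ 1) (ht : 0 ≤ t)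
    (hC : (C * Real.exp 1) ^ (k + 1) * summingNorm 1 1 (ContinuousLinearMap.id ℂ X) ≤ 1) :
    ∑ α ∈ Finset.piAntidiag (Finset.univ : Finset (Fin n)) (k + 1), ‖monomialCoeff f α‖ ^ p *
        ((C * t ^ (1 / p) * (n : ℝ) ^ (-(1 / q).toReal) *
          (Real.log n / n) ^ ((1 - (1 / q).toReal) / p)) ^ p) ^ (k + 1) ≤
      M ^ p * (t ^ (k + 1) * 2 ^ k) := by
  have hL : 0 < Real.log n := Real.log_pos (by exact_mod_cast hn)
  have hn0 : (0 : ℝ) < n := by exact_mod_cast (by omega : 0 < n)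
  set s := (1 / q).toReal with hs
  set θ := 1 - s with hθ
  have hp0 : p ≠ 0 := by linarith
  -- The powers of `n` match because `-s p - (1 - s) = -s (p - 1) - 1`: one factor cancels the
  -- coefficient bound to the power `p - 1`, the other enters the `ℓ_1` estimate.
  have hρ : (C * t ^ (1 / p) * (n : ℝ) ^ (-s) * (Real.log n / n) ^ (θ / p)) ^ p =
      C ^ p * t * (((n : ℝ) ^ s) ^ (p - 1))⁻¹ * (Real.log n ^ θ / n) := by
    rw [Real.mul_rpow (by positivity) (by positivity), Real.mul_rpow (by positivity)
      (by positivity), Real.mul_rpow hC0 (by positivity), ← Real.rpow_mul ht,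
      ← Real.rpow_mul (div_nonneg hL.le hn0.le), ← Real.rpow_mul hn0.le, ← Real.rpow_mul hn0.le,
      one_div_mul_cancel hp0, div_mul_cancel₀ _ hp0, Real.rpow_one, ← Real.rpow_neg hn0.le,
      Real.div_rpow hL.le hn0.le, div_eq_mul_inv, div_eq_mul_inv, ← Real.rpow_neg hn0.le]
    have h1 : (n : ℝ) ^ (-s * p) * (n : ℝ) ^ (-θ) = (n : ℝ) ^ (-(s * (p - 1))) * (n : ℝ)⁻¹ := by
      rw [← Real.rpow_neg_one, ← Real.rpow_add hn0, ← Real.rpow_add hn0]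
      congr 1
      rw [hθ]; ring
    linear_combination C ^ p * t * Real.log n ^ θ * h1
  rw [hρ]
  -- This is where `C ≤ 1` makes the constant independent of `p`.
  have hCp : C ^ p ≤ C := by
    rw [Real.rpow_eq_self_mul_rpow_sub_one hC0 hp]
    exact mul_le_of_le_one_right hC0 (Real.rpow_le_one hC0 hC1 (by linarith))
  set D : ℝ := ((n : ℝ) ^ s) ^ (p - 1) with hD
  have hD0 : 0 < D := by positivity
  have hterm : ∀ α ∈ Finset.piAntidiag (Finset.univ : Finset (Fin n)) (k + 1),
      ‖monomialCoeff f α‖ ^ p ≤ ‖monomialCoeff f α‖ * (M ^ (p - 1) * D ^ (k + 1)) := by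
    intro α hα
    rw [Real.rpow_eq_self_mul_rpow_sub_one (norm_nonneg _) hp]
    refine mul_le_mul_of_nonneg_left ?_ (norm_nonneg _)
    refine (Real.rpow_le_rpow (norm_nonneg _) (norm_monomialCoeff_le (by omega) hf hM hM0 hα)
      (by linarith)).trans (le_of_eq ?_)
    rw [Real.mul_rpow hM0 (by positivity), hD,
      Real.rpow_pow_comm (x := (n : ℝ) ^ s) (by positivity)]
  have hsum := sum_norm_monomialCoeff_le hn hf hM hM0 k
  set S := ∑ α ∈ Finset.piAntidiag (Finset.univ : Finset (Fin n)) (k + 1), ‖monomialCoeff f α‖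
    with hS
  have hS0 : 0 ≤ S := Finset.sum_nonneg fun _ _ => norm_nonneg _
  rw [← Finset.sum_mul]
  calc _ ≤ (S * (M ^ (p - 1) * D ^ (k + 1))) *
        (C * t * D⁻¹ * (Real.log n ^ θ / n)) ^ (k + 1) := by
        gcongr
        rw [hS, Finset.sum_mul]
        exact Finset.sum_le_sum hterm
    _ = M ^ (p - 1) * t ^ (k + 1) * (C * Real.exp 1) ^ (k + 1) *
        (S * (Real.exp (-1) * Real.log n ^ θ / n) ^ (k + 1)) := by
        rw [Real.exp_neg]
        simp only [mul_pow, div_pow, inv_pow]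
        field_simp
    _ ≤ M ^ (p - 1) * t ^ (k + 1) * (C * Real.exp 1) ^ (k + 1) *
        (summingNorm 1 1 (ContinuousLinearMap.id ℂ X) * (M * 2 ^ k)) := by gcongr
    _ = (M * M ^ (p - 1)) * (t ^ (k + 1) * 2 ^ k) *
        ((C * Real.exp 1) ^ (k + 1) * summingNorm 1 1 (ContinuousLinearMap.id ℂ X)) := by ring
    _ ≤ (M * M ^ (p - 1)) * (t ^ (k + 1) * 2 ^ k) * 1 := by gcongr
    _ = _ := by rw [mul_one, ← Real.rpow_eq_self_mul_rpow_sub_one hM0 hp]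

end HomogeneousPart

/-! ### Exponents, summation over degrees, and the Bohr radius -/

section BohrRadius

theorem ENNReal.one_le_conjExponent (q : ℝ≥0∞) : 1 ≤ q.conjExponent := le_self_add

theorem ENNReal.toReal_one_div_conjExponent {q : ℝ≥0∞} (hq : 1 ≤ q) :
    (1 / q.conjExponent).toReal = 1 - (1 / q).toReal := by
  have := ENNReal.HolderConjugate.conjExponent hq
  have h1 := ENNReal.HolderConjugate.inv_add_inv_eq_one q q.conjExponent
  have h2 : q⁻¹ ≠ ∞ := ENNReal.inv_ne_top.2 (zero_lt_one.trans_le hq).ne'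
  have h3 : q.conjExponent⁻¹ ≠ ∞ :=
    ENNReal.inv_ne_top.2 (zero_lt_one.trans_le (ENNReal.one_le_conjExponent q)).ne'
  have h4 := congrArg ENNReal.toReal h1
  rw [ENNReal.toReal_add h2 h3, ENNReal.toReal_one] at h4
  rw [one_div, one_div]
  linarith

theorem one_sub_toReal_one_div_bohrExponent {p : ℝ} (hp : 1 ≤ p) {q : ℝ≥0∞} (hq : 1 ≤ q) :
    1 - (1 / bohrExponent p q).toReal = (1 - (1 / q).toReal) / p := by
  have hP : 1 ≤ ENNReal.ofReal p * q.conjExponent :=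
    one_le_mul (by rwa [ENNReal.one_le_ofReal]) (ENNReal.one_le_conjExponent q)
  rw [bohrExponent, ENNReal.toReal_one_div_conjExponent hP, ← ENNReal.toReal_one_div_conjExponent hq,
    one_div, one_div, ENNReal.toReal_inv, ENNReal.toReal_inv, ENNReal.toReal_mul,
    ENNReal.toReal_ofReal (by linarith), mul_inv]
  ring

theorem ENNReal.tsum_eq_tsum_sum_piAntidiag {n : ℕ} (F : (Fin n → ℕ) → ℝ≥0∞) :
    ∑' α, F α = ∑' m, ∑ α ∈ Finset.piAntidiag Finset.univ m, F α := by
  have h1 : ∀ α, F α = ∑' m, if ∑ i, α i = m then F α else 0 := by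
    intro α
    rw [tsum_ite_eq']
  rw [tsum_congr h1, ENNReal.tsum_comm]
  refine tsum_congr fun m => ?_
  rw [tsum_eq_sum (s := Finset.piAntidiag Finset.univ m)]
  · refine Finset.sum_congr rfl fun α hα => ?_
    rw [if_pos (Finset.mem_piAntidiag.1 hα).1]
  · intro α hα
    refine if_neg fun h => hα ?_
    rw [Finset.mem_piAntidiag]
    exact ⟨h, fun _ _ => Finset.mem_univ _⟩

/-- With `t = (λ-1)/(2λ-1)` one has `1 - 2t = 1/(2λ-1)`, so the tail sums to `B t/(1-2t) = B (λ-1)`,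
exactly what the degree zero term leaves available. -/
theorem ENNReal.tsum_le_of_geometric_bound {a : ℕ → ℝ≥0∞} {B lam : ℝ} (hB : 0 ≤ B)
    (hlam : 1 ≤ lam) (h0 : a 0 ≤ ENNReal.ofReal B)
    (h : ∀ k, a (k + 1) ≤ ENNReal.ofReal
      (B * (((lam - 1) / (2 * lam - 1)) ^ (k + 1) * 2 ^ k))) :
    ∑' m, a m ≤ ENNReal.ofReal (lam * B) := by
  set t := (lam - 1) / (2 * lam - 1) with ht
  have hd : 0 < 2 * lam - 1 := by linarith
  have ht0 : 0 ≤ t := div_nonneg (by linarith) hd.le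
  have h2t : 1 - 2 * t = (2 * lam - 1)⁻¹ := by rw [ht]; field_simp; ring
  have h2t1 : 2 * t < 1 := by
    have : 0 < 1 - 2 * t := by rw [h2t]; positivity
    linarith
  have hg := (hasSum_geometric_of_lt_one (by positivity) h2t1).mul_left (B * t)
  have hval : B * t * (1 - 2 * t)⁻¹ = B * (lam - 1) := by
    rw [h2t, inv_inv, ht, mul_assoc, div_mul_cancel₀ _ hd.ne']
  rw [hval] at hg
  rw [tsum_eq_zero_add' ENNReal.summable]
  have h1 : ∑' k, a (k + 1) ≤ ENNReal.ofReal (B * (lam - 1)) := by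
    rw [← hg.tsum_eq, ENNReal.ofReal_tsum_of_nonneg (fun k => by positivity) hg.summable]
    refine ENNReal.tsum_le_tsum fun k => (h k).trans (le_of_eq ?_)
    congr 1
    rw [mul_pow]; ring
  refine (add_le_add h0 h1).trans (le_of_eq ?_)
  rw [← ENNReal.ofReal_add hB (mul_nonneg hB (by linarith))]
  congr 1
  ring

theorem exists_ballSupNorm_eq_ofReal {n : ℕ} {q : ℝ≥0∞} [Fact (1 ≤ q)]
    {X : Type*} [NormedAddCommGroup X] [NormedSpace ℂ X] {f : EllNQ n q → X}
    (hf : f ∈ HInfty n q X) :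
    ∃ M : ℝ, 0 ≤ M ∧ ballSupNorm f = ENNReal.ofReal M ∧
      ∀ z ∈ Metric.ball (0 : EllNQ n q) 1, ‖f z‖ ≤ M := by
  obtain ⟨-, K, hK⟩ := hf
  have hfin : ballSupNorm f ≠ ∞ := by
    refine ne_top_of_le_ne_top (ENNReal.ofReal_ne_top (r := K)) (iSup₂_le fun z hz => ?_)
    rw [← ofReal_norm]
    exact ENNReal.ofReal_le_ofReal (hK z hz)
  refine ⟨(ballSupNorm f).toReal, ENNReal.toReal_nonneg, (ENNReal.ofReal_toReal hfin).symm,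
    fun z hz => ?_⟩
  rw [← toReal_enorm]
  exact ENNReal.toReal_mono hfin (le_iSup₂ (f := fun z _ => ‖f z‖ₑ) z hz)

variable {X : Type*} [NormedAddCommGroup X] [NormedSpace ℂ X] [FiniteDimensional ℂ X]

theorem ofReal_le_arithmeticBohrRadius {n : ℕ} (hn : 1 < n) {q : ℝ≥0∞} [Fact (1 ≤ q)]
    {p lam C : ℝ} (hp : 1 ≤ p) (hlam : 1 ≤ lam) (hC0 : 0 ≤ C) (hC1 : C ≤ 1)
    (hC : ∀ k : ℕ,
      (C * Real.exp 1) ^ (k + 1) * summingNorm 1 1 (ContinuousLinearMap.id ℂ X) ≤ 1) :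
    ENNReal.ofReal (C * ((lam - 1) / (2 * lam - 1)) ^ (1 / p) * (n : ℝ) ^ (-(1 / q).toReal) *
        (Real.log n / n) ^ ((1 - (1 / q).toReal) / p)) ≤ arithmeticBohrRadius p n q X lam := by
  have hL : 0 < Real.log n := Real.log_pos (by exact_mod_cast hn)
  have ht0 : 0 ≤ (lam - 1) / (2 * lam - 1) := div_nonneg (by linarith) (by linarith)
  set ρ := C * ((lam - 1) / (2 * lam - 1)) ^ (1 / p) * (n : ℝ) ^ (-(1 / q).toReal) *
        (Real.log n / n) ^ ((1 - (1 / q).toReal) / p) with hρ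
  have hρ0 : 0 ≤ ρ := by positivity
  have hp0 : 0 ≤ p := by linarith
  rw [arithmeticBohrRadius, arithmeticBohrRadiusOf]
  refine le_iSup₂_of_le (fun _ => ρ.toNNReal) ?_ (le_of_eq ?_)
  · intro f hf
    obtain ⟨M, hM0, hMf, hM⟩ := exists_ballSupNorm_eq_ofReal hf
    rw [hMf, ENNReal.ofReal_rpow_of_nonneg hM0 hp0, ← ENNReal.ofReal_mul (by linarith),
      ENNReal.tsum_eq_tsum_sum_piAntidiag]
    have hterm : ∀ m, ∑ α ∈ Finset.piAntidiag (Finset.univ : Finset (Fin n)) m,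
        ‖monomialCoeff f α‖ₑ ^ p * ∏ i : Fin n, (ρ.toNNReal : ℝ≥0∞) ^ (p * (α i : ℝ)) =
        ENNReal.ofReal (∑ α ∈ Finset.piAntidiag (Finset.univ : Finset (Fin n)) m,
          ‖monomialCoeff f α‖ ^ p * (ρ ^ p) ^ m) := by
      intro m
      rw [ENNReal.ofReal_sum_of_nonneg fun α _ => by positivity]
      refine Finset.sum_congr rfl fun α hα => ?_
      have h1 : ∏ i : Fin n, (ρ.toNNReal : ℝ≥0∞) ^ (p * (α i : ℝ)) =
          ENNReal.ofReal ((ρ ^ p) ^ m) := by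
        rw [← (Finset.mem_piAntidiag.1 hα).1, ← Finset.prod_pow_eq_pow_sum,
          ENNReal.ofReal_prod_of_nonneg fun i _ => by positivity]
        refine Finset.prod_congr rfl fun i _ => ?_
        rw [ENNReal.rpow_mul, ENNReal.rpow_natCast, ENNReal.ofReal_pow (by positivity),
          ← ENNReal.ofReal_rpow_of_nonneg hρ0 hp0]
        rfl
      rw [h1, ENNReal.ofReal_mul (by positivity),
        ← ENNReal.ofReal_rpow_of_nonneg (norm_nonneg _) hp0, ofReal_norm]
    refine ENNReal.tsum_le_of_geometric_bound (by positivity) hlam ?_ fun k => ?_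
    · rw [hterm]
      refine ENNReal.ofReal_le_ofReal ?_
      have h2 := norm_monomialCoeff_le (by omega) hf.1 hM hM0 (m := 0) (α := 0) (by simp)
      simp only [Finset.piAntidiag_zero, Finset.sum_singleton, pow_zero, mul_one] at h2 ⊢
      exact Real.rpow_le_rpow (norm_nonneg _) h2 hp0
    · rw [hterm]
      exact ENNReal.ofReal_le_ofReal
        (sum_norm_monomialCoeff_rpow_le hn hf.1 hM hM0 k hp hC0 hC1 ht0 (hC k))
  · rw [Finset.sum_const, Finset.card_univ, Fintype.card_fin, nsmul_eq_mul]
    have hn0 : (n : ℝ≥0∞) ≠ 0 := by exact_mod_cast (by omega : n ≠ 0)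
    rw [mul_comm, ENNReal.mul_div_cancel_right hn0 (ENNReal.natCast_ne_top n)]
    rfl

end BohrRadius

theorem mainTheorem5 (X : Type*) [NormedAddCommGroup X] [NormedSpace ℂ X]
    [FiniteDimensional ℂ X] [Nontrivial X] :
    ∃ C : ℝ, 0 < C ∧
      C = Real.exp (-1) *
        ⨅ m : ℕ+, summingNorm 1 1 (ContinuousLinearMap.id ℂ X) ^ (-(1 / (m : ℝ))) ∧
      ∀ (p lam : ℝ) (q : ℝ≥0∞) [Fact (1 ≤ q)] (n : ℕ), 1 ≤ p → 1 ≤ lam → 1 < n →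
        (q ≤ bohrExponent p q →
          ENNReal.ofReal
              (C * ((lam - 1) / (2 * lam - 1)) ^ (1 / p) * (n : ℝ) ^ (-(1 / q).toReal) *
                (Real.log n / n) ^ (1 - (1 / bohrExponent p q).toReal))
            ≤ arithmeticBohrRadius p n q X lam) ∧
        (bohrExponent p q < q →
          ENNReal.ofReal
              (C * ((lam - 1) / (2 * lam - 1)) ^ (1 / p) *
                (n : ℝ) ^ (-(1 / bohrExponent p q).toReal) *
                (Real.log n / n) ^ (1 - (1 / bohrExponent p q).toReal))
            ≤ arithmeticBohrRadius p n q X lam) := by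
  set K := summingNorm 1 1 (ContinuousLinearMap.id ℂ X) with hK
  have hK1 : 1 ≤ K := one_le_summingNorm_one_one_id
  have hK0 : 0 < K := by linarith
  set I := ⨅ m : ℕ+, K ^ (-(1 / (m : ℝ))) with hI
  have hIle : ∀ m : ℕ+, I ≤ K ^ (-(1 / (m : ℝ))) := fun m =>
    ciInf_le ⟨0, by rintro _ ⟨m, rfl⟩; positivity⟩ m
  -- Every `K^{-1/m}` is at least `K⁻¹`, since `K ≥ 1`.
  have hI0 : 0 < I := by
    refine (inv_pos.2 hK0).trans_le (le_ciInf fun m => ?_)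
    rw [← Real.rpow_neg_one]
    refine Real.rpow_le_rpow_of_exponent_le hK1 (neg_le_neg ?_)
    rw [div_le_one (by exact_mod_cast m.pos)]
    exact_mod_cast m.pos
  have hI1 : I ≤ 1 := (hIle 1).trans (Real.rpow_le_one_of_one_le_of_nonpos hK1 (by norm_num))
  have hC1 : Real.exp (-1) * I ≤ 1 :=
    mul_le_one₀ (Real.exp_le_one_iff.2 (by norm_num)) hI0.le hI1
  have hC : ∀ k : ℕ, (Real.exp (-1) * I * Real.exp 1) ^ (k + 1) * K ≤ 1 := by
    intro k
    have h1 : Real.exp (-1) * I * Real.exp 1 = I := by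
      rw [mul_right_comm, ← Real.exp_add]
      simp
    have h2 := hIle k.succPNat
    rw [Nat.succPNat_coe] at h2
    have h3 : I ^ (k + 1) ≤ K⁻¹ := by
      refine (pow_le_pow_left₀ hI0.le h2 (k + 1)).trans (le_of_eq ?_)
      rw [← Real.rpow_natCast, ← Real.rpow_mul hK0.le, ← Real.rpow_neg_one]
      congr 1
      push_cast
      field_simp
    rw [h1]
    calc I ^ (k + 1) * K ≤ K⁻¹ * K := by gcongr
      _ = 1 := inv_mul_cancel₀ hK0.ne'
  refine ⟨Real.exp (-1) * I, by positivity, rfl, ?_⟩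
  intro p lam q hq n hp hlam hn
  have hmain := ofReal_le_arithmeticBohrRadius (X := X) (q := q) hn hp hlam
    (by positivity : 0 ≤ Real.exp (-1) * I) hC1 hC
  rw [← one_sub_toReal_one_div_bohrExponent hp hq.out] at hmain
  -- The first bound holds for every `q`; for `r < q` it is the stronger one.
  refine ⟨fun _ => hmain, fun hlt => le_trans (ENNReal.ofReal_le_ofReal ?_) hmain⟩
  have ht0 : 0 ≤ (lam - 1) / (2 * lam - 1) := div_nonneg (by linarith) (by linarith)
  have hn1 : (1 : ℝ) ≤ n := by exact_mod_cast hn.le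
  have hL : 0 ≤ Real.log n / n := div_nonneg (Real.log_nonneg hn1) (by linarith)
  have hr : 1 ≤ bohrExponent p q := ENNReal.one_le_conjExponent _
  have h1 : (1 / q).toReal ≤ (1 / bohrExponent p q).toReal := by
    refine ENNReal.toReal_mono ?_ (ENNReal.div_le_div_left hlt.le 1)
    rw [one_div]
    exact ENNReal.inv_ne_top.2 (zero_lt_one.trans_le hr).ne'
  gcongr
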